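/- Setting. Let $P\subset\mathbb R^\nu$, $W\subset\mathbb R^r$, $Z\subset\mathbb R^n$, $\Xi\subset\mathbb R^d$ ($d\ge 1$) be compact. Let $s:\mathbb R^r\to\mathbb R^r$ be locally Lipschitz, $y_r:\mathbb R^r\to\mathbb R$, $f:\mathbb R^n\times\mathbb R\times\mathbb R^\nu\to\mathbb R^n$ and $q:\mathbb R^n\times\mathbb R\times\mathbb R^\nu\to\mathbb R$ be $C^1$, and let $W$ be invariant in forward time for $\dot w=s(w)$. Write $\mathbf z=(\mu,w,z)$, $$\mathbf f_0(\mathbf z)=(0,\,s(w),\,f(z,y_r(w),\mu)),\qquad \mathbf q_0(\mathbf z)=L_sy_r(w)-q(z,y_r(w),\mu),$$ $\tau_1=\mathbf q_0$, $\tau_{i+1}=\frac{\partial\tau_i}{\partial\mathbf z}\mathbf f_0$, and suppose that $\tau_1,\dots,\tau_d$ are $C^1$; put $\tau=(\tau_1,\dots,\tau_d)$. Let $|x|_S$ be the distance of $x$ from $S$. Assume: (a) the positive orbit of $\mathbf Z=P\times W\times Z$ under $\dot{\mathbf z}=\mathbf f_0(\mathbf z)$ is contained in a compact subset of $P\times W\times\mathbb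 R^n$ and, with $\mathcal A_0=\omega(\mathbf Z)$ its $\omega$-limit set, there are $d_1>0$, $m\ge1$, $a>0$ and $0<d_2\le d_1$ such that, for $\mathbf z_0\in P\times W\times\mathbb R^n$, $|\mathbf z_0|_{\mathcal A_0}\le d_1$ implies $\mathbf z_0\in\mathbf Z$, and $|\mathbf z_0|_{\mathcal A_0}\le d_2$ implies $|\mathbf z(t)|_{\mathcal A_0}\le m e^{-at}|\mathbf z_0|_{\mathcal A_0}$ for all $t\ge0$ along the solution with $\mathbf z(0)=\mathbf z_0$; (b) there is a locally Lipschitz $\varphi:\mathbb R^d\to\mathbb R$ such that, along every solution $\mathbf z(t)$ of $\dot{\mathbf z}=\mathbf f_0(\mathbf z)$ starting in $\mathcal A_0$, the function $u(t)=\mathbf q_0(\mathbf z(t))$ satisfies $u^{(d)}+\varphi(u,u',\dots,u^{(d-1)})=0$ on $[0,\infty)$. Let $\varphi_c$ be a locally Lipschitz function of compact support that agrees with $\varphi$ on $\tau(\mathcal A_0)$, let $\Phi_c(\xi)=(\xi_2,\dots,\xi_d,-\varphi_c(\xi))$ and $\Gamma\xi=\xi_1$, let $c_0,\dots,c_{d-1}$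 be such that all roots of $\lambda^d+c_{d-1}\lambda^{d-1}+\dots+c_0$ have negative real part, and let $G=(\kappa c_{d-1},\kappa^2c_{d-2},\dots,\kappa^dc_0)$. For $p=(\mu,w,z,\tilde\xi)$ and $e\in\mathbb R$ put $$F_0(p)=\big(\mathbf f_0(\mathbf z),\ \Phi_c(\tilde\xi)+G(\mathbf q_0(\mathbf z)-\Gamma\tilde\xi)\big),\qquad H_0(p)=\Gamma\tilde\xi-\mathbf q_0(\mathbf z),$$ and let $F_1,H_1$ be defined by $$H_0(p)+H_1(p,e)e=h(p,e):=q(z,e+y_r(w),\mu)-L_sy_r(w)+\Gamma(\tilde\xi+Ge),$$ $$F_0(p)+F_1(p,e)e=\big(0,\ s(w),\ f(z,e+y_r(w),\mu),\ \Phi_c(\tilde\xi+Ge)-G\,h(p,e)\big).$$ Let $\mathcal A=\{(\mathbf z,\xi):\mathbf z\in\mathcal A_0,\ \xi=\tau(\mathbf z)\}$, let $\mathcal D$ be its domain of attraction for $\dot p=F_0(p)$ in $P\times W\times\mathbb R^n\times\mathbb R^d$, and let $E=\{e:|e|\le c\}$ with $c>0$. Claim. There is $\kappa^*>0$ such that for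 every $\kappa\ge\kappa^*$ one has $\mathbf Z\times\Xi\subset\mathcal D$ and, for every compact set $\mathcal P\subset\mathcal D$ (in particular for every sublevel set $\{p\in\mathcal D: V(p)\le a\}$ of a continuous proper function $V$ on $\mathcal D$), there is $k^*$ such that for all $k>k^*$: (i) the solutions of $$\dot p=F_0(p)+F_1(p,e)e,\qquad \dot e=H_0(p)+H_1(p,e)e-ke$$ with initial conditions in $\mathcal P\times E$ exist for all $t\ge 0$, the positive orbit of $\mathcal P\times E$ is bounded, and $|p(t)|_{\mathcal A}\to0$ and $e(t)\to0$ as $t\to\infty$ along each of them; (ii) for every $\varepsilon>0$ there are $\delta_1>0$ and $\delta_2>0$ such that, for all $p_0\in P\times W\times\mathbb R^n\times\mathbb R^d$ and $e_0\in\mathbb R$ with $|p_0|_{\mathcal A}\le\delta_1$ and $|e_0|\le\delta_1$ and every continuous $u:[0,\infty)\to\mathbb R$ with $|u(t)|\le\delta_2$ for all $t\ge0$, the solution of $$\dot p=F_0(p)+F_1(p,e)e,\qquad \dot e=H_0(p)+H_1(p,e)e-ke+u(t)$$ with $p(0)=p_0$, $e(0)=e_0$ exists for all $t\ge0$ and satisfies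 $|p(t)|_{\mathcal A}\le\varepsilon$ and $|e(t)|\le\varepsilon$ for all $t\ge0$. -/

import Mathlib

open Set Filter Topology

noncomputable section

namespace RemoteTracking

/-- The Euclidean space of dimension `k`. -/
abbrev Vec (k : ℕ) := EuclideanSpace ℝ (Fin k)

/-! ### Differential equations on the half-line -/

/-- `x` solves `ẋ = v(t, x)` on `[0, ∞)` (with the right derivative at `t = 0`). The values of `x`
at negative times are irrelevant. -/
def IsSolution {E : Type*} [NormedAddCommGroup E] [NormedSpace ℝ E]
    (v : ℝ → E → E) (x : ℝ → E) : Prop :=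
  ∀ t, 0 ≤ t → HasDerivWithinAt x (v t (x t)) (Ici 0) t

/-- `K` is invariant in forward time for `ẋ = v(x)`: through every point of `K` there is a solution
on `[0, ∞)` that stays in `K`. -/
def ForwardInvariant {E : Type*} [NormedAddCommGroup E] [NormedSpace ℝ E]
    (v : E → E) (K : Set E) : Prop :=
  ∀ x₀ ∈ K, ∃ x : ℝ → E, IsSolution (fun _ => v) x ∧ x 0 = x₀ ∧ ∀ t, 0 ≤ t → x t ∈ K

/-- The `ω`-limit set of the set `K` of initial conditions under `ẋ = v(x)`: the points that are
limits of `x_j(t_j)` with `t_j → ∞` and `x_j` solutions starting in `K`. -/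
def omegaSet {E : Type*} [NormedAddCommGroup E] [NormedSpace ℝ E]
    (v : E → E) (K : Set E) : Set E :=
  ⋂ T : ℝ, closure {y | ∃ x : ℝ → E, IsSolution (fun _ => v) x ∧ x 0 ∈ K ∧
    ∃ t, 0 ≤ t ∧ T ≤ t ∧ x t = y}

/-! ### Exosystem and plant -/

/-- The functions defining the exosystem `ẇ = s(w)`, `y_des = yr(w)`, and the plant
`ż = f(z, y, μ)`, `ẏ = q(z, y, μ) + u`. -/
structure Plant (ν r n : ℕ) where
  s : Vec r → Vec r
  yr : Vec r → ℝ
  f : Vec n × ℝ × Vec ν → Vec n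
  q : Vec n × ℝ × Vec ν → ℝ

/-- The space of the variable `(μ, w, z)`. -/
abbrev ZSpace (ν r n : ℕ) := Vec ν × Vec r × Vec n

/-- The space of the variable `p = (μ, w, z, ξ)`. -/
abbrev PSpace (ν r n d : ℕ) := ZSpace ν r n × Vec d

namespace Plant

variable {ν r n d : ℕ} (S : Plant ν r n)

/-- The derivative `L_s y_r` of `y_r` along `s`. -/
def Lsyr (w : Vec r) : ℝ := fderiv ℝ S.yr w (S.s w)

/-- The vector field of `μ̇ = 0`, `ẇ = s(w)`, `ż = f(z, y_r(w), μ)`. -/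
def f0 (z : ZSpace ν r n) : ZSpace ν r n :=
  (0, S.s z.2.1, S.f (z.2.2, S.yr z.2.1, z.1))

/-- The steady-state input `L_s y_r(w) - q(z, y_r(w), μ)`. -/
def q0 (z : ZSpace ν r n) : ℝ :=
  S.Lsyr z.2.1 - S.q (z.2.2, S.yr z.2.1, z.1)

/-- The iterated derivatives of `q0` along `f0` (indexed from `0`). -/
def tauSeq : ℕ → ZSpace ν r n → ℝ
  | 0 => S.q0
  | i + 1 => fun z => fderiv ℝ (tauSeq i) z (S.f0 z)

/-- The map `τ = (q0, L q0, …, L^{d-1} q0)`, `L` being the derivative along `f0`. -/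
def tau (d : ℕ) (z : ZSpace ν r n) : Vec d :=
  WithLp.toLp 2 (fun i : Fin d => S.tauSeq i z)

/-- The `ω`-limit set of `P × W × Z` under `f0`. -/
def A0 (P : Set (Vec ν)) (W : Set (Vec r)) (Z : Set (Vec n)) : Set (ZSpace ν r n) :=
  omegaSet S.f0 (P ×ˢ W ×ˢ Z)

/-- The graph of the restriction of `τ` to `A0`. -/
def A (d : ℕ) (P : Set (Vec ν)) (W : Set (Vec r)) (Z : Set (Vec n)) : Set (PSpace ν r n d) :=
  {p | p.1 ∈ S.A0 P W Z ∧ p.2 = S.tau d p.1}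

/-- The dynamics of `(μ, w, z)` have a compact attractor that is locally exponentially stable,
relative to `P × W × ℝⁿ`. -/
def HasExpStableAttractor (P : Set (Vec ν)) (W : Set (Vec r)) (Z : Set (Vec n)) : Prop :=
  (∃ K : Set (ZSpace ν r n), IsCompact K ∧ K ⊆ P ×ˢ W ×ˢ univ ∧
    ∀ z₀ ∈ P ×ˢ W ×ˢ Z, ∃ x : ℝ → ZSpace ν r n,
      IsSolution (fun _ => S.f0) x ∧ x 0 = z₀ ∧ ∀ t, 0 ≤ t → x t ∈ K) ∧
  ∃ d₁ > 0,
    (∀ z ∈ P ×ˢ W ×ˢ (univ : Set (Vec n)),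
      Metric.infDist z (S.A0 P W Z) ≤ d₁ → z ∈ P ×ˢ W ×ˢ Z) ∧
    ∃ m ≥ 1, ∃ a > 0, ∃ d₂ > 0, d₂ ≤ d₁ ∧
      ∀ z₀ ∈ P ×ˢ W ×ˢ (univ : Set (Vec n)), Metric.infDist z₀ (S.A0 P W Z) ≤ d₂ →
        ∀ x : ℝ → ZSpace ν r n, IsSolution (fun _ => S.f0) x → x 0 = z₀ →
          ∀ t, 0 ≤ t → Metric.infDist (x t) (S.A0 P W Z) ≤
            m * Real.exp (-a * t) * Metric.infDist z₀ (S.A0 P W Z)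

/-- Immersion: along every solution in `A0` the output `u(t) = q0(z(t))` satisfies
`u^{(d)} + φ(u, u', …, u^{(d-1)}) = 0`. -/
def SatisfiesImmersion (P : Set (Vec ν)) (W : Set (Vec r)) (Z : Set (Vec n))
    (φ : Vec d → ℝ) : Prop :=
  ∀ x : ℝ → ZSpace ν r n, IsSolution (fun _ => S.f0) x → x 0 ∈ S.A0 P W Z →
    ∀ t, 0 ≤ t →
      iteratedDerivWithin d (fun t' => S.q0 (x t')) (Ici 0) t +
        φ (WithLp.toLp 2 (fun i : Fin d =>
          iteratedDerivWithin i (fun t' => S.q0 (x t')) (Ici 0) t)) = 0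

end Plant

/-! ### The regulator -/

/-- All the roots of `λ^d + c_{d-1} λ^{d-1} + ⋯ + c_0` have negative real part. -/
def IsHurwitz {d : ℕ} (c : Fin d → ℝ) : Prop :=
  ∀ l : ℂ, l ^ d + ∑ i : Fin d, (c i : ℂ) * l ^ (i : ℕ) = 0 → l.re < 0

/-- The gain vector `G = (κ c_{d-1}, κ² c_{d-2}, …, κ^d c_0)`. -/
def gain {d : ℕ} (c : Fin d → ℝ) (κ : ℝ) : Vec d :=
  WithLp.toLp 2 (fun i : Fin d => κ ^ ((i : ℕ) + 1) * c i.rev)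

/-- `Φ_c(ξ) = (ξ_2, …, ξ_d, -φ_c(ξ))`. -/
def PhiC {d : ℕ} (φc : Vec d → ℝ) (ξ : Vec d) : Vec d :=
  WithLp.toLp 2 (fun i : Fin d => if h : (i : ℕ) + 1 < d then ξ ⟨(i : ℕ) + 1, h⟩ else -φc ξ)

/-! ### The closed-loop system

With `y = e + y_r(w)` and `u = Γ ξ - k e`, `Γ ξ = ξ_1`, the closed loop is
`ẇ = s(w)`, `ż = f(z, e + y_r(w), μ)`, `ξ̇ = Φ_c(ξ) - k e G`,
`ė = q(z, e + y_r(w), μ) - L_s y_r(w) + Γ ξ - k e`.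
It is written in the variables `p = (μ, w, z, ξ - e G)` and `e`. -/

namespace Plant

variable {ν r n d : ℕ} [NeZero d] (S : Plant ν r n)

/-- The right-hand side of the equation of `e`, without the term `-k e`. -/
def eField (G : Vec d) (p : PSpace ν r n d) (e : ℝ) : ℝ :=
  S.q (p.1.2.2, e + S.yr p.1.2.1, p.1.1) - S.Lsyr p.1.2.1 + (p.2 + e • G) 0

/-- The right-hand side of the equation of `p`; in the last component the terms in `k` cancel. -/
def pField (φc : Vec d → ℝ) (G : Vec d) (p : PSpace ν r n d) (e : ℝ) : PSpace ν r n d :=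
  ((0, S.s p.1.2.1, S.f (p.1.2.2, e + S.yr p.1.2.1, p.1.1)),
    PhiC φc (p.2 + e • G) - S.eField G p e • G)

/-- `F0(p) = (0, s(w), f(z, y_r(w), μ), Φ_c(ξ) + (q0(μ, w, z) - Γ ξ) G)`. -/
def F0 (φc : Vec d → ℝ) (G : Vec d) (p : PSpace ν r n d) : PSpace ν r n d :=
  (S.f0 p.1, PhiC φc p.2 + (S.q0 p.1 - p.2 0) • G)

/-- `H0(p) = q(z, y_r(w), μ) - L_s y_r(w) + Γ ξ`. -/
def H0 (p : PSpace ν r n d) : ℝ :=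
  S.q (p.1.2.2, S.yr p.1.2.1, p.1.1) - S.Lsyr p.1.2.1 + p.2 0

/-- The factor `F1(p, e)` in `pField p e = F0 p + F1(p, e) e`, that is, the difference quotient in
`e` (the value at `e = 0` is the derivative, where it exists, and is irrelevant in the product). -/
def F1 (φc : Vec d → ℝ) (G : Vec d) (p : PSpace ν r n d) (e : ℝ) : PSpace ν r n d :=
  dslope (S.pField φc G p) 0 e

/-- The factor `H1(p, e)` in `eField p e = H0 p + H1(p, e) e`. -/
def H1 (G : Vec d) (p : PSpace ν r n d) (e : ℝ) : ℝ :=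
  dslope (S.eField G p) 0 e

theorem H0_add_H1 (G : Vec d) (p : PSpace ν r n d) (e : ℝ) :
    S.H0 p + S.H1 G p e * e = S.eField G p e := by
  have h := sub_smul_dslope (S.eField G p) 0 e
  have h0 : S.eField G p 0 = S.H0 p := by simp [eField, H0]
  rw [h0, sub_zero, smul_eq_mul] at h
  unfold H1
  linarith

theorem F0_add_F1 (φc : Vec d → ℝ) (G : Vec d) (p : PSpace ν r n d) (e : ℝ) :
    S.F0 φc G p + e • S.F1 φc G p e = S.pField φc G p e := by
  have h := sub_smul_dslope (S.pField φc G p) 0 e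
  have h0 : S.pField φc G p 0 = S.F0 φc G p := by
    simp [pField, F0, f0, q0, eField, sub_eq_add_neg, ← neg_smul]
    congr 1
    ring
  rw [h0, sub_zero] at h
  unfold F1
  rw [h]
  abel

/-- The vector field of the perturbed system
`ṗ = F0(p) + F1(p, e) e`, `ė = H0(p) + H1(p, e) e - k e + u(t)`. -/
def closedLoop (φc : Vec d → ℝ) (G : Vec d) (k : ℝ) (u : ℝ → ℝ)
    (t : ℝ) (x : PSpace ν r n d × ℝ) : PSpace ν r n d × ℝ :=
  (S.F0 φc G x.1 + x.2 • S.F1 φc G x.1 x.2,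
    S.H0 x.1 + S.H1 G x.1 x.2 * x.2 - k * x.2 + u t)

/-- The domain of attraction of `A` for `ṗ = F0(p)`, in the state space `P × W × ℝⁿ × ℝᵈ`. -/
def domainOfAttraction (P : Set (Vec ν)) (W : Set (Vec r)) (Z : Set (Vec n))
    (φc : Vec d → ℝ) (G : Vec d) : Set (PSpace ν r n d) :=
  {p₀ | p₀.1 ∈ P ×ˢ W ×ˢ (univ : Set (Vec n)) ∧
    ∃ x : ℝ → PSpace ν r n d, IsSolution (fun _ => S.F0 φc G) x ∧ x 0 = p₀ ∧
      Tendsto (fun t => Metric.infDist (x t) (S.A d P W Z)) atTop (𝓝 0)}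

/-- The positive orbits from `K × E`, `E = [-c, c]`, are defined on `[0, ∞)`, they are bounded
uniformly over all initial conditions, and along each of them `p` tends to `A` and `e` to `0`. -/
def BoundedAndConvergent (P : Set (Vec ν)) (W : Set (Vec r)) (Z : Set (Vec n))
    (φc : Vec d → ℝ) (G : Vec d) (k c : ℝ) (K : Set (PSpace ν r n d)) : Prop :=
  (∀ p₀ ∈ K, ∀ e₀ : ℝ, |e₀| ≤ c → ∃ x : ℝ → PSpace ν r n d × ℝ,
    IsSolution (S.closedLoop φc G k (fun _ => 0)) x ∧ x 0 = (p₀, e₀)) ∧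
  Bornology.IsBounded {y : PSpace ν r n d × ℝ | ∃ x : ℝ → PSpace ν r n d × ℝ,
    IsSolution (S.closedLoop φc G k (fun _ => 0)) x ∧ (x 0).1 ∈ K ∧ |(x 0).2| ≤ c ∧
      ∃ t, 0 ≤ t ∧ x t = y} ∧
  ∀ x : ℝ → PSpace ν r n d × ℝ, IsSolution (S.closedLoop φc G k (fun _ => 0)) x →
    (x 0).1 ∈ K → |(x 0).2| ≤ c →
      Tendsto (fun t => Metric.infDist (x t).1 (S.A d P W Z)) atTop (𝓝 0) ∧
      Tendsto (fun t => (x t).2) atTop (𝓝 0)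

/-- Local total stability of `A × {0}`. -/
def LocallyTotallyStable (P : Set (Vec ν)) (W : Set (Vec r)) (Z : Set (Vec n))
    (φc : Vec d → ℝ) (G : Vec d) (k : ℝ) : Prop :=
  ∀ ε > 0, ∃ δ₁ > 0, ∃ δ₂ > 0,
    ∀ p₀ : PSpace ν r n d, p₀.1 ∈ P ×ˢ W ×ˢ (univ : Set (Vec n)) →
      Metric.infDist p₀ (S.A d P W Z) ≤ δ₁ → ∀ e₀ : ℝ, |e₀| ≤ δ₁ →
      ∀ u : ℝ → ℝ, ContinuousOn u (Ici 0) → (∀ t, 0 ≤ t → |u t| ≤ δ₂) →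
        (∃ x : ℝ → PSpace ν r n d × ℝ,
          IsSolution (S.closedLoop φc G k u) x ∧ x 0 = (p₀, e₀)) ∧
        ∀ x : ℝ → PSpace ν r n d × ℝ,
          IsSolution (S.closedLoop φc G k u) x → x 0 = (p₀, e₀) →
            ∀ t, 0 ≤ t → Metric.infDist (x t).1 (S.A d P W Z) ≤ ε ∧ |(x t).2| ≤ ε

end Plant

end RemoteTracking

end

open RemoteTracking

/-!
The closed loop is the nominal system `ṗ = F₀(p)` perturbed by `e`, and `ė = H(p, e) - k e + u` with
`H` vanishing on `A × {0}`. Everything follows once `A` is known to be exponentially stable for the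
nominal system.

The nominal system is a cascade: `ż = f₀(z)` drives the high-gain observer
`ξ̇ = Φ_c(ξ) + (q₀(z) - ξ₁) G`. Along solutions `α` inside `A₀` the immersion property makes
`τ(α(t))` an exact solution of `σ̇ = Φ_c(σ)` with `σ₁ = q₀(α)` (`Plant.isSolution_tau`). A solution
`z` near `A₀` is therefore compared with the solution `α` that starts at the point of `A₀` nearest
to `z(0)`: over a bounded time `z - α` is bounded linearly by the initial distance to `A₀`, so the
observer tracks `τ(α)` with a measurement error of that order. Since `φ_c` is globally Lipschitz, the
error of the observer decays exponentially up to a multiple of the measurement error when `κ` is large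
(`exists_observerErrorBound`; the rescaled error dynamics are dissipative in a Hermitian norm
adapted to the Hurwitz polynomial, `exists_dissipative_of_eigenvalues_re_neg`). Over a long time
window the weighted sum of `|ξ - τ(z)|` and `|z|_{A₀}` is halved (`DrivingSystem.exists_window`).
Iterating the window gives exponential stability of the graph `A`
(`DrivingSystem.exists_graph_contraction`), and `Z × Ξ` is attracted because every orbit from
`Z` gets close to `A₀`.

For the closed loop let the nominal system halve the distance to `A` in time `T`. If the field is
globally Lipschitz, then over `[0, T]` the deviation of `p` from the nominal solution is linear in
`sup |e|`, while `e` is, after a fast transient, of order `(|p|_A + |u|) / k`. For large `k` this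
loop closes: `|p|_A + ρ |e|` contracts on every window (`exists_window_contraction`), which gives
local input-to-state stability (`exists_local_iss`). A field that is only locally Lipschitz is cut
off outside a ball. For initial conditions in a compact part of the domain of attraction, a large `k`
makes `p` follow the nominal solution into the region of local stability while `e` becomes small
(`exists_transient_bound`), and compactness yields a uniform gain
(`exists_gain_attracted_compact`).
-/

namespace RemoteTracking

/-! ### Solutions on the half-line -/

section ODE

variable {E F : Type*} [NormedAddCommGroup E] [NormedSpace ℝ E]
  [NormedAddCommGroup F] [NormedSpace ℝ F]

theorem IsSolution.continuousOn {v : ℝ → E → E} {x : ℝ → E} (hx : IsSolution v x) :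
    ContinuousOn x (Ici 0) :=
  fun t ht => (hx t ht).continuousWithinAt

theorem IsSolution.hasDerivWithinAt_Ici {v : ℝ → E → E} {x : ℝ → E} (hx : IsSolution v x)
    {t : ℝ} (ht : 0 ≤ t) : HasDerivWithinAt x (v t (x t)) (Ici t) t :=
  (hx t ht).mono (Ici_subset_Ici.2 ht)

theorem IsSolution.continuous_max {v : ℝ → E → E} {x : ℝ → E} (hx : IsSolution v x) :
    Continuous fun t => x (max t 0) :=
  hx.continuousOn.comp_continuous (by fun_prop) fun t => le_max_right t 0

theorem IsSolution.congr {v w : ℝ → E → E} {x : ℝ → E} (hx : IsSolution v x)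
    (h : ∀ t, 0 ≤ t → v t (x t) = w t (x t)) : IsSolution w x :=
  fun t ht => h t ht ▸ hx t ht

theorem IsSolution.shift {v : ℝ → E → E} {x : ℝ → E} (hx : IsSolution v x) {s : ℝ} (hs : 0 ≤ s) :
    IsSolution (fun t => v (s + t)) (fun t => x (s + t)) := by
  intro t ht
  have h1 : HasDerivWithinAt (fun t : ℝ => s + t) 1 (Ici 0) t :=
    ((hasDerivAt_id t).const_add s).hasDerivWithinAt
  have h2 := (hx (s + t) (by positivity)).scomp t h1
    (fun r (hr : 0 ≤ r) => show (0 : ℝ) ≤ s + r by positivity)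
  rw [one_smul] at h2
  exact h2

/-- A vector field that is continuous in time and Lipschitz in the state, with a uniform constant,
has a solution on `[0, ∞)` through every initial state. -/
theorem exists_isSolution [CompleteSpace E] {v : ℝ → E → E} {K : NNReal}
    (hK : ∀ t, LipschitzWith K (v t)) (hc : ∀ x, Continuous fun t => v t x) (x₀ : E) :
    ∃ x : ℝ → E, IsSolution v x ∧ x 0 = x₀ := by
  -- a step length that works everywhere: `(C + K (C + 1)) h ≤ C + 1` for every `C ≥ 0`
  set h : ℝ := 1 / (K + 1) with hh
  have hpos : 0 < h := by positivity
  have step : ∀ (t₀ : ℝ) (a : E), ∃ y : ℝ → E, y t₀ = a ∧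
      ∀ t ∈ Icc t₀ (t₀ + h), HasDerivWithinAt y (v t (y t)) (Icc t₀ (t₀ + h)) t := by
    intro t₀ a
    obtain ⟨C, hC⟩ := (isCompact_Icc (a := t₀) (b := t₀ + h)).exists_bound_of_continuousOn
      (hc a).continuousOn
    have hC0 : 0 ≤ C := (norm_nonneg _).trans (hC t₀ ⟨le_rfl, by linarith⟩)
    have hp : IsPicardLindelof v (⟨t₀, le_rfl, by linarith⟩ : Icc t₀ (t₀ + h)) a
        ⟨C, hC0⟩ 0 (⟨C, hC0⟩ + K * ⟨C, hC0⟩) K := by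
      refine ⟨fun t _ => (hK t).lipschitzOnWith, fun x _ => (hc x).continuousOn, ?_, ?_⟩
      · intro t ht x hx
        have h1 := (hK t).dist_le_mul x a
        have h2 : ‖v t x‖ ≤ ‖v t a‖ + dist (v t x) (v t a) := by
          rw [dist_eq_norm]; exact norm_le_insert' _ _
        have h3 : (K : ℝ) * dist x a ≤ K * C := by
          gcongr; exact hx
        have := hC t ht
        change _ ≤ C + K * C
        linarith
      · have : max (t₀ + h - t₀) (t₀ - t₀) = h := by
          rw [sub_self, add_sub_cancel_left]; exact max_eq_left hpos.le
        change ((_ : NNReal) : ℝ) * max (t₀ + h - t₀) (t₀ - t₀) ≤ C - 0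
        rw [this, hh]
        change (C + K * C) * (1 / (K + 1)) ≤ C - 0
        apply le_of_eq
        field_simp
        ring
    exact hp.exists_eq_forall_mem_Icc_hasDerivWithinAt₀
  choose Y hY0 hY using step
  let a : ℕ → E := fun n => Nat.rec x₀ (fun n an => Y (n * h) an (n * h + h)) n
  have ha : ∀ n, a (n + 1) = Y (n * h) (a n) (n * h + h) := fun n => rfl
  let x : ℝ → E := fun t => Y (⌊t / h⌋₊ * h) (a ⌊t / h⌋₊) t
  have hxn : ∀ n : ℕ, x (n * h) = a n := by
    intro n
    have : ⌊(n * h) / h⌋₊ = n := by rw [mul_div_cancel_right₀ _ hpos.ne', Nat.floor_natCast]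
    simp only [x, this, hY0]
  have hxe : ∀ n : ℕ, ∀ t ∈ Icc (n * h) (n * h + h), x t = Y (n * h) (a n) t := by
    intro n t ht
    rcases ht.2.eq_or_lt with h1 | h1
    · have : t = ((n + 1 : ℕ) : ℝ) * h := by rw [h1]; push_cast; ring
      rw [this, hxn, ha]
      congr 1
      push_cast; ring
    · have : ⌊t / h⌋₊ = n := by
        rw [Nat.floor_eq_iff (div_nonneg ((by positivity : (0 : ℝ) ≤ n * h).trans ht.1) hpos.le),
          le_div_iff₀ hpos, div_lt_iff₀ hpos]
        exact ⟨ht.1, by linarith⟩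
      simp only [x, this]
  have hxd : ∀ n : ℕ, ∀ t ∈ Icc (n * h) (n * h + h),
      HasDerivWithinAt x (v t (x t)) (Icc (n * h) (n * h + h)) t := by
    intro n t ht
    rw [hxe n t ht]
    exact (hY _ _ t ht).congr (fun s hs => hxe n s hs) (hxe n t ht)
  refine ⟨x, ?_, by simpa [a] using hxn 0⟩
  intro t ht
  set n := ⌊t / h⌋₊ with hn
  have h1 : n * h ≤ t := by
    rw [← le_div_iff₀ hpos]; exact Nat.floor_le (by positivity)
  have h2 : t < n * h + h := by
    have := Nat.lt_floor_add_one (t / h)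
    rw [div_lt_iff₀ hpos] at this
    linarith
  have hd := hxd n t ⟨h1, h2.le⟩
  rcases h1.eq_or_lt with h3 | h3
  · rcases Nat.eq_zero_or_pos n with h4 | h4
    · refine hd.mono_of_mem_nhdsWithin ?_
      have h5 : t = 0 := by rw [← h3, h4]; simp
      rw [h3, h5]
      exact Icc_mem_nhdsGE (by linarith)
    · obtain ⟨m, hm⟩ : ∃ m, n = m + 1 := ⟨n - 1, by omega⟩
      have h6 : (m : ℝ) * h + h = t := by rw [← h3, hm]; push_cast; ring
      have hd' := hxd m t ⟨by linarith, h6.ge⟩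
      refine (hd'.union hd).mono_of_mem_nhdsWithin (mem_nhdsWithin_of_mem_nhds ?_)
      rw [h3, h6, Icc_union_Icc_eq_Icc (by linarith) (by linarith)]
      exact Icc_mem_nhds (by linarith) (by linarith)
  · exact hd.mono_of_mem_nhdsWithin (mem_nhdsWithin_of_mem_nhds (Icc_mem_nhds h3 h2))

/-- A scalar function with `f' ≤ -β f + M` wherever it is nonnegative decays exponentially up to
`M / β`. -/
theorem le_exp_add_of_deriv_le {f f' : ℝ → ℝ} {β M b T : ℝ} (hβ : 0 < β) (hM : 0 ≤ M) (hb : 0 ≤ b)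
    (hf : ContinuousOn f (Icc 0 T)) (hf' : ∀ t ∈ Ico 0 T, HasDerivWithinAt f (f' t) (Ici t) t)
    (h0 : f 0 ≤ b) (bound : ∀ t ∈ Ico 0 T, 0 ≤ f t → f' t ≤ -β * f t + M) :
    ∀ t ∈ Icc 0 T, f t ≤ b * Real.exp (-β * t) + M / β := by
  have key : ∀ ε > 0, ∀ t ∈ Icc 0 T, f t ≤ b * Real.exp (-β * t) + (M + ε) / β := by
    intro ε hε
    have hB : ∀ t, HasDerivAt (fun t => b * Real.exp (-β * t) + (M + ε) / β)
        (b * (Real.exp (-β * t) * -β)) t := by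
      intro t
      have h1 : HasDerivAt (fun t : ℝ => -β * t) (-β) t := by
        simpa using (hasDerivAt_id t).const_mul (-β)
      exact (h1.exp.const_mul b).add_const _
    refine image_le_of_deriv_right_lt_deriv_boundary hf hf' ?_ hB ?_
    · simp only [mul_zero, Real.exp_zero, mul_one]
      have : 0 ≤ (M + ε) / β := by positivity
      linarith
    · intro t ht heq
      have h1 : 0 ≤ f t := by rw [heq]; positivity
      have h2 := bound t ht h1
      rw [heq] at h2
      have h3 : β * ((M + ε) / β) = M + ε := by field_simp
      linarith
  intro t ht
  refine le_of_forall_pos_le_add fun ε hε => ?_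
  have := key (ε * β) (by positivity) t ht
  rw [add_div, mul_div_cancel_right₀ _ hβ.ne'] at this
  linarith

/-- Uniqueness on `[0, T]` for `ẋ = v(x) + g(t)` with locally Lipschitz `v`; no regularity of the
forcing term `g` is needed, because it cancels in the difference of two solutions. -/
theorem eqOn_of_locallyLipschitz [ProperSpace E] {v : E → E} (hv : LocallyLipschitz v) {g : ℝ → E}
    {x y : ℝ → E} {T : ℝ} (hx : ContinuousOn x (Icc 0 T)) (hy : ContinuousOn y (Icc 0 T))
    (hx' : ∀ t ∈ Ico 0 T, HasDerivWithinAt x (v (x t) + g t) (Ici t) t)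
    (hy' : ∀ t ∈ Ico 0 T, HasDerivWithinAt y (v (y t) + g t) (Ici t) t) (h0 : x 0 = y 0) :
    EqOn x y (Icc 0 T) := by
  have hS : IsCompact (x '' Icc 0 T ∪ y '' Icc 0 T) :=
    (isCompact_Icc.image_of_continuousOn hx).union (isCompact_Icc.image_of_continuousOn hy)
  obtain ⟨K, hK⟩ := hv.locallyLipschitzOn.exists_lipschitzOnWith_of_compact hS
  have hK' : ∀ t ∈ Ico 0 T, LipschitzOnWith K (fun z => v z + g t)
      (x '' Icc 0 T ∪ y '' Icc 0 T) := by
    intro t _ a ha b hb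
    simpa using hK ha hb
  exact ODE_solution_unique_of_mem_Icc_right hK' hx hx'
    (fun t ht => Or.inl ⟨t, Ico_subset_Icc_self ht, rfl⟩) hy hy'
    (fun t ht => Or.inr ⟨t, Ico_subset_Icc_self ht, rfl⟩) h0

theorem IsSolution.eqOn [ProperSpace E] {v : E → E} (hv : LocallyLipschitz v) {g : ℝ → E}
    {x y : ℝ → E} (hx : IsSolution (fun t z => v z + g t) x)
    (hy : IsSolution (fun t z => v z + g t) y) (h0 : x 0 = y 0) : EqOn x y (Ici 0) := by
  intro t ht
  exact eqOn_of_locallyLipschitz hv (hx.continuousOn.mono Icc_subset_Ici_self)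
    (hy.continuousOn.mono Icc_subset_Ici_self) (fun s hs => hx.hasDerivWithinAt_Ici hs.1)
    (fun s hs => hy.hasDerivWithinAt_Ici hs.1) h0 (right_mem_Icc.2 ht)

theorem IsSolution.eqOn_autonomous [ProperSpace E] {v : E → E} (hv : LocallyLipschitz v)
    {x y : ℝ → E} (hx : IsSolution (fun _ => v) x)
    (hy : IsSolution (fun _ => v) y) (h0 : x 0 = y 0) : EqOn x y (Ici 0) :=
  IsSolution.eqOn hv (g := fun _ => 0) (by simpa using hx) (by simpa using hy) h0

/-- A locally Lipschitz map agrees on a given ball with a bounded and globally Lipschitz one, which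
moreover vanishes wherever the original map does. -/
theorem exists_lipschitz_bounded_eq_on_ball {E : Type*} [NormedAddCommGroup E] [ProperSpace E]
    {v : E → F} (hv : LocallyLipschitz v)
    (R : ℝ) : ∃ (g : E → F) (L : NNReal) (B : ℝ), LipschitzWith L g ∧ (∀ x, ‖g x‖ ≤ B) ∧
      (∀ x, ‖x‖ ≤ R → g x = v x) ∧ ∀ x, v x = 0 → g x = 0 := by
  let θ : E → ℝ := fun x => max 0 (min 1 (R + 1 - ‖x‖))
  have hθ0 : ∀ x, 0 ≤ θ x := fun x => le_max_left _ _
  have hθ1 : ∀ x, θ x ≤ 1 := fun x => max_le zero_le_one (min_le_left _ _)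
  have hθo : ∀ x, R + 1 ≤ ‖x‖ → θ x = 0 := fun x hx =>
    max_eq_left ((min_le_right _ _).trans (by linarith))
  have hθl : ∀ x y, |θ x - θ y| ≤ ‖x - y‖ := by
    intro x y
    have h1 : θ x - θ y ≤ ‖x - y‖ := by
      have := norm_sub_norm_le y x
      rw [norm_sub_rev] at this
      have h0 := norm_nonneg (x - y)
      simp only [θ]
      grind only [= max_def, = min_def]
    have h2 : θ y - θ x ≤ ‖x - y‖ := by
      have := norm_sub_norm_le x y
      have h0 := norm_nonneg (x - y)
      simp only [θ]
      grind only [= max_def, = min_def]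
    exact abs_le.2 ⟨by linarith, h1⟩
  have hcomp : IsCompact (Metric.closedBall (0 : E) (R + 1)) := isCompact_closedBall _ _
  obtain ⟨K, hK⟩ := hv.locallyLipschitzOn.exists_lipschitzOnWith_of_compact hcomp
  obtain ⟨B, hB⟩ := hcomp.exists_bound_of_continuousOn hv.continuous.continuousOn
  have hball : ∀ x : E, ‖x‖ ≤ R + 1 → x ∈ Metric.closedBall (0 : E) (R + 1) := fun x hx => by
    simpa using hx
  have hB' : ∀ x, ‖x‖ ≤ R + 1 → ‖v x‖ ≤ |B| := fun x hx =>
    (hB x (hball x hx)).trans (le_abs_self B)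
  have hmix : ∀ x y, ‖x‖ ≤ R + 1 → ‖θ x • v x - θ y • v y‖ ≤ (K + |B|) * ‖x - y‖ := by
    intro x y hx
    rcases le_or_gt ‖y‖ (R + 1) with hy | hy
    · have e : θ x • v x - θ y • v y = (θ x - θ y) • v x + θ y • (v x - v y) := by
        rw [sub_smul, smul_sub]; abel
      rw [e]
      refine (norm_add_le _ _).trans ?_
      rw [norm_smul, norm_smul, Real.norm_eq_abs, Real.norm_eq_abs, abs_of_nonneg (hθ0 y)]
      have h1 := hK.norm_sub_le (hball x hx) (hball y hy)
      have h2 : |θ x - θ y| * ‖v x‖ ≤ ‖x - y‖ * |B| :=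
        mul_le_mul (hθl x y) (hB' x hx) (norm_nonneg _) (norm_nonneg _)
      have h3 : θ y * ‖v x - v y‖ ≤ 1 * (K * ‖x - y‖) :=
        mul_le_mul (hθ1 y) h1 (norm_nonneg _) zero_le_one
      linarith
    · rw [hθo y hy.le, zero_smul, sub_zero, norm_smul, Real.norm_eq_abs]
      have h1 := hθl x y
      rw [hθo y hy.le, sub_zero] at h1
      have h2 : |θ x| * ‖v x‖ ≤ ‖x - y‖ * |B| :=
        mul_le_mul h1 (hB' x hx) (norm_nonneg _) (norm_nonneg _)
      have h3 : 0 ≤ (K : ℝ) * ‖x - y‖ := by positivity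
      linarith
  refine ⟨fun x => θ x • v x, K + ⟨|B|, abs_nonneg B⟩, |B|, ?_, ?_, ?_, ?_⟩
  · refine LipschitzWith.of_dist_le_mul fun x y => ?_
    rw [dist_eq_norm, dist_eq_norm]
    change _ ≤ (K + |B|) * _
    rcases le_or_gt ‖x‖ (R + 1) with hx | hx
    · exact hmix x y hx
    · rcases le_or_gt ‖y‖ (R + 1) with hy | hy
      · rw [norm_sub_rev, norm_sub_rev x]
        exact hmix y x hy
      · simp only [hθo x hx.le, hθo y hy.le, zero_smul, sub_zero, norm_zero]
        positivity
  · intro x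
    rw [norm_smul, Real.norm_eq_abs, abs_of_nonneg (hθ0 x)]
    rcases le_or_gt ‖x‖ (R + 1) with hx | hx
    · exact (mul_le_of_le_one_left (norm_nonneg _) (hθ1 x)).trans (hB' x hx)
    · simp [hθo x hx.le]
  · intro x hx
    have : θ x = 1 := by
      simp only [θ]
      rw [min_eq_left (by linarith), max_eq_right zero_le_one]
    simp only [this, one_smul]
  · intro x hx
    simp only [hx, smul_zero]

theorem exists_lipschitzWith_of_hasCompactSupport {E : Type*} [NormedAddCommGroup E]
    [ProperSpace E] {v : E → F}
    (hv : LocallyLipschitz v) (hs : HasCompactSupport v) : ∃ L, LipschitzWith L v := by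
  obtain ⟨R, hR⟩ := hs.isCompact.isBounded.exists_norm_le
  obtain ⟨g, L, _, hL, -, hg, hg0⟩ := exists_lipschitz_bounded_eq_on_ball hv R
  have : g = v := by
    funext x
    by_cases hx : x ∈ tsupport v
    · exact hg x (hR x hx)
    · rw [hg0 x (image_eq_zero_of_notMem_tsupport hx), image_eq_zero_of_notMem_tsupport hx]
  exact ⟨L, this ▸ hL⟩

end ODE

/-! ### Dissipativity in an adapted norm -/

section Lyapunov

/-- A complex linear map all of whose eigenvalues have negative real part is strictly dissipative
for some Hermitian norm `v ↦ ‖S v‖`. By induction on the dimension: the kernel `U` of a left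
eigenvector `l` is invariant, and on `V = U ⊕ ℂ v₀` the norm `|m l(v)|² + |S u|²` with `m` large
absorbs the coupling of `l(v)` into `U`. -/
theorem exists_dissipative_of_eigenvalues_re_neg :
    ∀ (N : ℕ) (V : Type) [AddCommGroup V] [Module ℂ V] [FiniteDimensional ℂ V]
      (T : Module.End ℂ V), Module.finrank ℂ V = N → (∀ l, T.HasEigenvalue l → l.re < 0) →
      ∃ (S : V →ₗ[ℂ] EuclideanSpace ℂ (Fin N)) (α : ℝ), 0 < α ∧ Function.Injective S ∧
        ∀ v, (inner ℂ (S v) (S (T v))).re ≤ -α * ‖S v‖ ^ 2 := by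
  intro N
  induction N with
  | zero =>
    intro V _ _ _ T hV _
    have := Module.finrank_zero_iff.1 hV
    exact ⟨0, 1, one_pos, Function.injective_of_subsingleton _, fun v => by simp⟩
  | succ N ih =>
    intro V _ _ _ T hV hT
    have : Nontrivial V := Module.nontrivial_of_finrank_pos (R := ℂ) (by omega)
    obtain ⟨μ, hμ⟩ := Module.End.exists_eigenvalue T
    -- a left eigenvector: a functional that vanishes on the range of `T - μ`
    have hlt : LinearMap.range (T - μ • 1) < ⊤ := by
      rw [lt_top_iff_ne_top, Ne, LinearMap.range_eq_top, ← LinearMap.injective_iff_surjective,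
        ← LinearMap.ker_eq_bot]
      simpa [Module.End.hasEigenvalue_iff, Module.End.eigenspace_def] using hμ
    obtain ⟨l, hl0, hl⟩ := Submodule.exists_le_ker_of_lt_top _ hlt
    have hlT : ∀ v, l (T v) = μ * l v := by
      intro v
      have : l ((T - μ • 1) v) = 0 := hl ⟨v, rfl⟩
      simpa [sub_eq_zero] using this
    obtain ⟨v₁, hv₁⟩ : ∃ v, l v ≠ 0 := by
      by_contra! h
      exact hl0 (LinearMap.ext h)
    obtain ⟨v₀, hv₀⟩ : ∃ v, l v = 1 := ⟨(l v₁)⁻¹ • v₁, by simp [hv₁]⟩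
    set U := LinearMap.ker l with hU
    have hTU : ∀ u ∈ U, T u ∈ U := by
      intro u hu
      rw [LinearMap.mem_ker] at hu ⊢
      rw [hlT, hu, mul_zero]
    have hrank : Module.finrank ℂ U = N := by
      have h1 : Module.finrank ℂ (LinearMap.range l) + Module.finrank ℂ U = Module.finrank ℂ V :=
        LinearMap.finrank_range_add_finrank_ker l
      have h2 : LinearMap.range l = ⊤ :=
        LinearMap.range_eq_top.2 fun c => ⟨c • v₀, by simp [hv₀]⟩
      rw [h2, finrank_top, Module.finrank_self] at h1
      omega
    obtain ⟨S, α, hα, hS, hSd⟩ := ih U (T.restrict hTU) hrank (by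
      intro k hk
      obtain ⟨u, hu⟩ := hk.exists_hasEigenvector
      refine hT k (Module.End.hasEigenvalue_of_hasEigenvector (x := (u : V)) ⟨?_, ?_⟩)
      · rw [Module.End.mem_eigenspace_iff]
        have := congrArg Subtype.val hu.apply_eq_smul
        simpa using this
      · simpa using hu.2)
    -- the projection onto the hyperplane `U` along `v₀`
    let π : V →ₗ[ℂ] U := LinearMap.codRestrict U (LinearMap.id - l.smulRight v₀) (by
      intro v; simp [hU, hv₀])
    have hπ : ∀ v, (π v : V) = v - l v • v₀ := fun v => rfl
    set w : U := π (T v₀) with hw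
    have hπT : ∀ v, π (T v) = T.restrict hTU (π v) + l v • w := by
      intro v
      apply Subtype.ext
      have e : T (v - l v • v₀) = T v - l v • T v₀ := by simp
      rw [Submodule.coe_add, LinearMap.coe_restrict_apply, hπ, hπ, Submodule.coe_smul, hw, hπ, e,
        hlT, hlT, hv₀, mul_one, smul_sub, smul_smul, mul_comm (l v) μ]
      abel
    have hb : 0 < -μ.re := by linarith [hT μ hμ]
    obtain ⟨m, hm0, hm⟩ : ∃ m : ℝ, 0 < m ∧ ‖S w‖ ^ 2 ≤ α * (-μ.re) * m ^ 2 := by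
      refine ⟨‖S w‖ ^ 2 / (α * (-μ.re)) + 1, by positivity, ?_⟩
      have h1 : 0 ≤ ‖S w‖ ^ 2 / (α * (-μ.re)) := by positivity
      calc ‖S w‖ ^ 2 = α * (-μ.re) * (‖S w‖ ^ 2 / (α * (-μ.re))) :=
          (mul_div_cancel₀ _ (by positivity)).symm
        _ ≤ _ := by
          gcongr
          nlinarith
    let S' : V →ₗ[ℂ] EuclideanSpace ℂ (Fin (N + 1)) :=
      (WithLp.linearEquiv 2 ℂ (Fin (N + 1) → ℂ)).symm.toLinearMap ∘ₗ LinearMap.pi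
        (Fin.cons ((m : ℂ) • l) fun i => (EuclideanSpace.proj i).toLinearMap ∘ₗ S ∘ₗ π)
    have hS0 : ∀ v, S' v 0 = m * l v := fun v => by simp [S']
    have hSs : ∀ v (i : Fin N), S' v i.succ = S (π v) i := fun v i => by simp [S']
    have hnorm : ∀ v, ‖S' v‖ ^ 2 = m ^ 2 * ‖l v‖ ^ 2 + ‖S (π v)‖ ^ 2 := by
      intro v
      rw [EuclideanSpace.norm_sq_eq, EuclideanSpace.norm_sq_eq, Fin.sum_univ_succ]
      simp only [hS0, hSs, norm_mul, mul_pow, Complex.norm_real, Real.norm_eq_abs, sq_abs]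
    have hinner : ∀ v, (inner ℂ (S' v) (S' (T v))).re =
        m ^ 2 * μ.re * ‖l v‖ ^ 2 + (inner ℂ (S (π v)) (S (π (T v)))).re := by
      intro v
      rw [PiLp.inner_apply, PiLp.inner_apply, Fin.sum_univ_succ]
      simp only [hS0, hSs, Complex.add_re, hlT]
      congr 1
      rw [← Complex.normSq_eq_norm_sq, Complex.normSq_apply]
      simp
      ring
    refine ⟨S', min (α / 2) (-μ.re / 2), by positivity, ?_, ?_⟩
    · rw [injective_iff_map_eq_zero]
      intro v hv
      have h1 := hnorm v
      rw [hv, norm_zero] at h1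
      have h2 : m ^ 2 * ‖l v‖ ^ 2 = 0 := by nlinarith [sq_nonneg ‖S (π v)‖, sq_nonneg (m * ‖l v‖)]
      have h3 : ‖S (π v)‖ ^ 2 = 0 := by nlinarith [sq_nonneg ‖S (π v)‖, sq_nonneg (m * ‖l v‖)]
      have h4 : l v = 0 := by simpa [hm0.ne'] using h2
      have h5 : π v = 0 := hS (by simpa using h3)
      have h6 := hπ v
      rw [h4, h5, zero_smul, sub_zero] at h6
      exact h6.symm
    · intro v
      rw [hinner, hnorm, hπT, map_add, map_smul, inner_add_right, inner_smul_right, Complex.add_re]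
      have h1 := hSd (π v)
      have h2 : (l v * inner ℂ (S (π v)) (S w)).re ≤ ‖l v‖ * (‖S (π v)‖ * ‖S w‖) := by
        refine (Complex.re_le_norm _).trans ?_
        rw [norm_mul]
        gcongr
        exact norm_inner_le_norm _ _
      set a := ‖S (π v)‖
      set q := ‖l v‖
      set z := ‖S w‖
      -- Young's inequality for the coupling term
      have h3 : q * (a * z) ≤ α / 2 * a ^ 2 + -μ.re / 2 * (m ^ 2 * q ^ 2) := by
        have h4 : q ^ 2 * z ^ 2 ≤ q ^ 2 * (α * (-μ.re) * m ^ 2) := by gcongr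
        have h5 : 0 ≤ (α * a - q * z) ^ 2 := sq_nonneg _
        have h6 : α * (q * (a * z)) ≤ α * (α / 2 * a ^ 2 + -μ.re / 2 * (m ^ 2 * q ^ 2)) := by
          nlinarith
        exact le_of_mul_le_mul_left h6 hα
      have h7 : min (α / 2) (-μ.re / 2) * (m ^ 2 * q ^ 2) ≤ -μ.re / 2 * (m ^ 2 * q ^ 2) := by
        gcongr; exact min_le_right _ _
      have h8 : min (α / 2) (-μ.re / 2) * a ^ 2 ≤ α / 2 * a ^ 2 := by
        gcongr; exact min_le_left _ _
      linarith

end Lyapunov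

/-! ### The high-gain observer -/

section Observer

/-- The linear part of the error dynamics of the observer at `κ = 1`: the companion matrix, in
observer form, of the polynomial with coefficients `c`. -/
def observerCompanion {d : ℕ} [NeZero d] (c : Fin d → ℝ) : Module.End ℂ (Fin d → ℂ) where
  toFun v i := (if h : (i : ℕ) + 1 < d then v ⟨i + 1, h⟩ else 0) - c i.rev * v 0
  map_add' u v := by
    funext i
    by_cases h : (i : ℕ) + 1 < d <;> simp [h] <;> ring
  map_smul' a v := by
    funext i
    by_cases h : (i : ℕ) + 1 < d <;> simp [h] <;> ring

/-- The eigenvector equation determines the entries of an eigenvector recursively from the first,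
and its last row says that the eigenvalue is a root of the polynomial. -/
theorem observerCompanion_eigenvalue_re_neg {d : ℕ} [NeZero d] {c : Fin d → ℝ} (hc : IsHurwitz c)
    {l : ℂ} (hl : (observerCompanion c).HasEigenvalue l) : l.re < 0 := by
  obtain ⟨v, hv⟩ := hl.exists_hasEigenvector
  have hd : 0 < d := Nat.pos_of_neZero d
  let w : ℕ → ℂ := fun i => if h : i < d then v ⟨i, h⟩ else 0
  let C : ℕ → ℂ := fun i => if h : i < d then (c (Fin.rev ⟨i, h⟩) : ℂ) else 0
  have hw0 : w 0 = v 0 := by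
    simp only [w, hd, dif_pos]; rfl
  have hrec : ∀ i < d, w (i + 1) = l * w i + C i * w 0 := by
    intro i hi
    have h1 := congrFun hv.apply_eq_smul ⟨i, hi⟩
    simp only [observerCompanion, LinearMap.coe_mk, AddHom.coe_mk, Pi.smul_apply,
      smul_eq_mul] at h1
    have h2 : w (i + 1) = if h : i + 1 < d then v ⟨i + 1, h⟩ else 0 := rfl
    have h3 : w i = v ⟨i, hi⟩ := by simp only [w, hi, dif_pos]
    have h4 : C i = c (Fin.rev ⟨i, hi⟩) := by simp only [C, hi, dif_pos]
    rw [h2, h3, h4, hw0, ← h1]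
    ring
  have hsol : ∀ n ≤ d, w n = (l ^ n + ∑ j ∈ Finset.range n, C j * l ^ (n - 1 - j)) * w 0 := by
    intro n
    induction n with
    | zero => intro _; simp
    | succ n ih =>
      intro hn
      have h1 : ∑ j ∈ Finset.range n, C j * l ^ (n + 1 - 1 - j) =
          l * ∑ j ∈ Finset.range n, C j * l ^ (n - 1 - j) := by
        rw [Finset.mul_sum]
        refine Finset.sum_congr rfl fun j hj => ?_
        have : n + 1 - 1 - j = (n - 1 - j) + 1 := by
          have := Finset.mem_range.1 hj
          omega
        rw [this]
        ring
      rw [hrec n (by omega), ih (by omega), Finset.sum_range_succ, h1]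
      simp only [add_tsub_cancel_right, tsub_self, pow_zero]
      ring
  have hne : w 0 ≠ 0 := by
    intro h0
    apply hv.2
    funext i
    have h1 := hsol i i.2.le
    rw [h0, mul_zero] at h1
    simpa [w] using h1
  have hroot : l ^ d + ∑ j ∈ Finset.range d, C j * l ^ (d - 1 - j) = 0 := by
    have h1 := hsol d le_rfl
    have h2 : w d = 0 := by simp [w]
    rw [h2] at h1
    exact (mul_eq_zero.1 h1.symm).resolve_right hne
  apply hc
  rw [← hroot, Finset.sum_range, ← Equiv.sum_comp Fin.revPerm]
  congr 1
  refine Finset.sum_congr rfl fun i _ => ?_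
  have h1 : ((Fin.rev i : Fin d) : ℕ) = d - 1 - i := by rw [Fin.val_rev]; omega
  simp only [Fin.revPerm_apply, C, i.2, dif_pos, Fin.eta, h1]

theorem hasDerivWithinAt_norm_sq {N : ℕ} {f : ℝ → EuclideanSpace ℂ (Fin N)}
    {f' : EuclideanSpace ℂ (Fin N)} {s : Set ℝ} {t : ℝ} (hf : HasDerivWithinAt f f' s t) :
    HasDerivWithinAt (fun t => ‖f t‖ ^ 2) (2 * (inner ℂ (f t) f').re) s t := by
  have h1 := (hf.inner ℂ hf)
  have h2 := Complex.reCLM.hasFDerivAt.comp_hasDerivWithinAt t h1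
  have h3 : (fun t => ‖f t‖ ^ 2) = Complex.reCLM ∘ fun t => inner ℂ (f t) (f t) := by
    funext t
    rw [Function.comp_apply, inner_self_eq_norm_sq_to_K]
    simp [← Complex.ofReal_pow]
  have h4 : Complex.reCLM (inner ℂ (f t) f' + inner ℂ f' (f t)) = 2 * (inner ℂ (f t) f').re := by
    rw [map_add, Complex.reCLM_apply, Complex.reCLM_apply, ← inner_conj_symm f' (f t),
      Complex.conj_re, two_mul]
  rw [h3, ← h4]
  exact h2

theorem norm_le_sqrt_mul_of_forall_abs_le {d : ℕ} {x : Vec d} {m : ℝ} (hm : 0 ≤ m)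
    (h : ∀ i, |x i| ≤ m) : ‖x‖ ≤ √d * m := by
  rw [EuclideanSpace.norm_eq]
  have : ∑ i, ‖x i‖ ^ 2 ≤ d * m ^ 2 := by
    have h1 : ∀ i ∈ (Finset.univ : Finset (Fin d)), ‖x i‖ ^ 2 ≤ m ^ 2 := fun i _ => by
      rw [Real.norm_eq_abs]; gcongr; exact h i
    simpa using Finset.sum_le_card_nsmul _ _ _ h1
  calc √(∑ i, ‖x i‖ ^ 2) ≤ √(d * m ^ 2) := Real.sqrt_le_sqrt this
    _ = √d * m := by rw [Real.sqrt_mul (by positivity), Real.sqrt_sq hm]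

/-- The error bound of the observer `ξ̇ = Φ(ξ) + (y - ξ₁) G` for a trajectory `σ` of `σ̇ = Φ(σ)`: if
the measurement `y` of `σ₁` has error at most `Γ`, then `ξ - σ` decays exponentially up to a
multiple of `Γ`. -/
def ObserverErrorBound {d : ℕ} [NeZero d] (φ : Vec d → ℝ) (G : Vec d) (C β : ℝ) : Prop :=
  ∀ (ξ σ : ℝ → Vec d) (y : ℝ → ℝ) (Γ T : ℝ), 0 ≤ Γ →
    ContinuousOn ξ (Icc 0 T) → ContinuousOn σ (Icc 0 T) →
    (∀ t ∈ Ico 0 T, HasDerivWithinAt ξ (PhiC φ (ξ t) + (y t - ξ t 0) • G) (Ici t) t) →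
    (∀ t ∈ Ico 0 T, HasDerivWithinAt σ (PhiC φ (σ t)) (Ici t) t) →
    (∀ t ∈ Ico 0 T, |y t - σ t 0| ≤ Γ) →
    ∀ t ∈ Icc 0 T, ‖ξ t - σ t‖ ≤ C * (Real.exp (-β * t) * ‖ξ 0 - σ 0‖ + Γ)

/-- The high-gain observer: for `κ` large the linear part of the error dynamics dominates the
Lipschitz nonlinearity, which enters the last equation only and is therefore bounded in the rescaled
coordinates independently of `κ`. -/
theorem exists_observerErrorBound {d : ℕ} [NeZero d] {φ : Vec d → ℝ} {Lφ : NNReal}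
    (hφ : LipschitzWith Lφ φ) {c : Fin d → ℝ} (hc : IsHurwitz c) :
    ∃ κ' > 0, ∀ κ ≥ κ', ∃ C ≥ 0, ∃ β > 0, ObserverErrorBound φ (gain c κ) C β := by
  obtain ⟨S, α, hα, hS, hSd⟩ := exists_dissipative_of_eigenvalues_re_neg d (Fin d → ℂ)
    (observerCompanion c) (by simp) (fun l hl => observerCompanion_eigenvalue_re_neg hc hl)
  obtain ⟨K, hK0, hK⟩ := S.exists_antilipschitzWith (LinearMap.ker_eq_bot.2 hS)
  have hK' : ∀ v, ‖v‖ ≤ K * ‖S v‖ := fun v => by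
    simpa using hK.le_mul_dist v 0
  obtain ⟨B, hB0, hB⟩ : ∃ B, 0 ≤ B ∧ ∀ v, ‖S v‖ ≤ B * ‖v‖ :=
    ⟨‖S.toContinuousLinearMap‖, norm_nonneg _, fun v => S.toContinuousLinearMap.le_opNorm v⟩
  set cb : ℝ := ‖c‖ with hcb
  have hcb' : ∀ i, |c i| ≤ cb := fun i => norm_le_pi_norm c i
  set D : ℝ := B * (Lφ * (√d * K)) with hD
  refine ⟨max 1 (2 * D / α), by positivity, fun κ hκ => ?_⟩
  have hκ1 : 1 ≤ κ := (le_max_left _ _).trans hκ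
  have hκ0 : 0 < κ := by linarith
  have hκD : 2 * D ≤ α * κ := by
    have := (le_max_right _ _).trans hκ
    rw [div_le_iff₀ hα] at this
    linarith
  -- the scaling `x_i ↦ κ^{-i} x_i` turns the gain `G` into `κ` times the gain for `κ = 1`
  let J : Vec d →ₗ[ℝ] (Fin d → ℂ) :=
    { toFun := fun x i => (((κ ^ (i : ℕ))⁻¹ * x i : ℝ) : ℂ)
      map_add' := fun x y => by funext i; simp [mul_add]
      map_smul' := fun a x => by funext i; simp; ring }
  have hJ : ∀ x i, J x i = (((κ ^ (i : ℕ))⁻¹ * x i : ℝ) : ℂ) := fun _ _ => rfl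
  let M : Vec d →L[ℝ] EuclideanSpace ℂ (Fin d) :=
    ((S.restrictScalars ℝ) ∘ₗ J).toContinuousLinearMap
  have hM : ∀ x, M x = S (J x) := fun _ => rfl
  have hxi : ∀ x i, |x i| ≤ κ ^ (d - 1) * (K * ‖M x‖) := by
    intro x i
    have h1 : |(κ ^ (i : ℕ))⁻¹ * x i| ≤ K * ‖M x‖ := by
      have h2 := norm_le_pi_norm (J x) i
      rw [hJ, Complex.norm_real, Real.norm_eq_abs] at h2
      exact h2.trans (hK' _)
    rw [abs_mul, abs_of_pos (by positivity : (0 : ℝ) < (κ ^ (i : ℕ))⁻¹),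
      inv_mul_le_iff₀ (by positivity)] at h1
    refine h1.trans (mul_le_mul_of_nonneg_right (pow_le_pow_right₀ hκ1 ?_) (by positivity))
    have := i.2
    omega
  have hx : ∀ x, ‖x‖ ≤ √d * (κ ^ (d - 1) * (K * ‖M x‖)) := fun x =>
    norm_le_sqrt_mul_of_forall_abs_le (by positivity) (hxi x)
  refine ⟨√d * κ ^ (d - 1) * K * (‖M‖ + 2 * B * cb / α), by positivity, α * κ / 4, by positivity,
    fun ξ σ y Γ T hΓ hξ hσ hξ' hσ' hy => ?_⟩
  set χ : ℝ → Vec d := fun t => ξ t - σ t with hχ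
  set χ' : ℝ → Vec d := fun t =>
    PhiC φ (ξ t) + (y t - ξ t 0) • gain c κ - PhiC φ (σ t) with hχ'
  have hder : ∀ t ∈ Ico 0 T, HasDerivWithinAt χ (χ' t) (Ici t) t := fun t ht =>
    (hξ' t ht).sub (hσ' t ht)
  have hMder : ∀ t ∈ Ico 0 T, HasDerivWithinAt (fun t => ‖M (χ t)‖ ^ 2)
      (2 * (inner ℂ (M (χ t)) (M (χ' t))).re) (Ici t) t := fun t ht =>
    hasDerivWithinAt_norm_sq (M.hasFDerivAt.comp_hasDerivWithinAt t (hder t ht))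
  -- in the rescaled coordinates the error dynamics are `κ` times the companion matrix, perturbed
  -- by a term that is bounded by `κ Γ` and by the error itself, uniformly in `κ`
  let b : ℝ → Fin d → ℂ := fun t i =>
    (((y t - σ t 0) * (κ * c i.rev) + (κ ^ (i : ℕ))⁻¹ *
      (if (i : ℕ) + 1 < d then 0 else -(φ (ξ t) - φ (σ t))) : ℝ) : ℂ)
  have hdec : ∀ t, J (χ' t) = (κ : ℂ) • observerCompanion c (J (χ t)) + b t := by
    intro t
    funext i
    have e1 : χ' t i = (if h : (i : ℕ) + 1 < d then χ t ⟨i + 1, h⟩ else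
        -(φ (ξ t) - φ (σ t))) + (y t - ξ t 0) * (κ ^ ((i : ℕ) + 1) * c i.rev) := by
      simp only [hχ', hχ, PhiC, gain, PiLp.sub_apply, PiLp.add_apply, PiLp.smul_apply, smul_eq_mul]
      split_ifs <;> ring
    have e2 : χ t 0 = ξ t 0 - σ t 0 := rfl
    have e3 : y t - ξ t 0 = (y t - σ t 0) - χ t 0 := by rw [e2]; ring
    have hp : (κ ^ (i : ℕ))⁻¹ * κ ^ ((i : ℕ) + 1) = κ := by
      rw [pow_succ]; field_simp
    simp only [Pi.add_apply, Pi.smul_apply, observerCompanion, LinearMap.coe_mk, AddHom.coe_mk,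
      smul_eq_mul, hJ, b, e1, e3]
    have h0 : ((0 : Fin d) : ℕ) = 0 := rfl
    have h4 : (κ ^ (i : ℕ))⁻¹ * ((y t - σ t 0 - χ t 0) * (κ ^ ((i : ℕ) + 1) * c i.rev)) =
        (y t - σ t 0 - χ t 0) * (κ * c i.rev) := by
      rw [mul_left_comm, ← mul_assoc _ (κ ^ ((i : ℕ) + 1)), hp]
    rw [mul_add, h4]
    split_ifs with h
    · have hp' : (κ ^ (i : ℕ))⁻¹ = κ * (κ ^ ((i : ℕ) + 1))⁻¹ := by
        rw [pow_succ]; field_simp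
      rw [hp', h0]
      push_cast
      ring
    · rw [h0]
      push_cast
      ring
  have hb : ∀ t ∈ Ico 0 T, ‖b t‖ ≤ κ * (cb * Γ) + Lφ * (√d * K) * ‖M (χ t)‖ := by
    intro t ht
    rw [pi_norm_le_iff_of_nonneg (by positivity)]
    intro i
    rw [Complex.norm_real, Real.norm_eq_abs]
    refine (abs_add_le _ _).trans (add_le_add ?_ ?_)
    · rw [abs_mul, abs_mul, abs_of_pos hκ0]
      have : |y t - σ t 0| * (κ * |c i.rev|) ≤ Γ * (κ * cb) := by
        gcongr
        · exact hy t ht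
        · exact hcb' _
      linarith
    · split_ifs with h
      · rw [mul_zero, abs_zero]; positivity
      · have hi : (i : ℕ) = d - 1 := by have := i.2; omega
        rw [abs_mul, abs_neg, abs_of_pos (by positivity : (0 : ℝ) < (κ ^ (i : ℕ))⁻¹),
          inv_mul_le_iff₀ (by positivity), hi]
        have h1 := hφ.dist_le_mul (ξ t) (σ t)
        rw [Real.dist_eq, dist_eq_norm] at h1
        refine h1.trans ?_
        calc (Lφ : ℝ) * ‖χ t‖ ≤ Lφ * (√d * (κ ^ (d - 1) * (K * ‖M (χ t)‖))) := by
              gcongr; exact hx _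
          _ = _ := by ring
  have hbound : ∀ t ∈ Ico 0 T, 2 * (inner ℂ (M (χ t)) (M (χ' t))).re ≤
      -(α * κ / 2) * ‖M (χ t)‖ ^ 2 + κ * (2 / α * (B * cb * Γ) ^ 2) := by
    intro t ht
    have e : M (χ' t) = (κ : ℂ) • S (observerCompanion c (J (χ t))) + S (b t) := by
      rw [hM, hdec, map_add, map_smul]
    rw [e, inner_add_right, inner_smul_right, Complex.add_re, Complex.re_ofReal_mul]
    have h1 : (inner ℂ (M (χ t)) (S (observerCompanion c (J (χ t))))).re ≤ -α * ‖M (χ t)‖ ^ 2 :=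
      hSd (J (χ t))
    set a := ‖M (χ t)‖
    have h2 : (inner ℂ (M (χ t)) (S (b t))).re ≤
        a * (B * (κ * (cb * Γ) + Lφ * (√d * K) * a)) := by
      refine (Complex.re_le_norm _).trans ((norm_inner_le_norm _ _).trans ?_)
      gcongr
      exact (hB _).trans (by gcongr; exact hb t ht)
    have h3 : κ * (inner ℂ (M (χ t)) (S (observerCompanion c (J (χ t))))).re ≤
        κ * (-α * a ^ 2) := by gcongr
    have h4 : a * (B * (κ * (cb * Γ) + Lφ * (√d * K) * a)) =
        κ * (a * (B * cb * Γ)) + D * a ^ 2 := by rw [hD]; ring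
    have h5 : 2 * D * a ^ 2 ≤ α * κ * a ^ 2 := by gcongr
    have h6 : 2 * (a * (B * cb * Γ)) ≤ α / 2 * a ^ 2 + 2 / α * (B * cb * Γ) ^ 2 := by
      have h7 : α / 2 * a ^ 2 + 2 / α * (B * cb * Γ) ^ 2 - 2 * (a * (B * cb * Γ)) =
          (α * a - 2 * (B * cb * Γ)) ^ 2 / (2 * α) := by field_simp; ring
      have h8 : 0 ≤ (α * a - 2 * (B * cb * Γ)) ^ 2 / (2 * α) := by positivity
      linarith
    have h9 := mul_le_mul_of_nonneg_left h6 hκ0.le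
    linarith
  intro t ht
  have hcont : ContinuousOn (fun t => ‖M (χ t)‖ ^ 2) (Icc 0 T) := by
    have : ContinuousOn χ (Icc 0 T) := hξ.sub hσ
    fun_prop
  have h1 := le_exp_add_of_deriv_le (β := α * κ / 2) (by positivity) (by positivity)
    (sq_nonneg ‖M (χ 0)‖) hcont hMder le_rfl (fun t ht _ => hbound t ht) t ht
  have h2 : ‖M (χ t)‖ ≤ ‖M (χ 0)‖ * Real.exp (-(α * κ / 4) * t) + 2 * B * cb / α * Γ := by
    refine abs_le_of_sq_le_sq' (h1.trans ?_) (by positivity) |>.2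
    have e1 : Real.exp (-(α * κ / 2) * t) = Real.exp (-(α * κ / 4) * t) ^ 2 := by
      rw [← Real.exp_nat_mul]; congr 1; push_cast; ring
    have e2 : κ * (2 / α * (B * cb * Γ) ^ 2) / (α * κ / 2) = (2 * B * cb / α * Γ) ^ 2 := by
      field_simp
    rw [e1, e2, add_sq, mul_pow]
    have : 0 ≤ 2 * (‖M (χ 0)‖ * Real.exp (-(α * κ / 4) * t)) * (2 * B * cb / α * Γ) := by
      positivity
    linarith
  have h3 : ‖M (χ 0)‖ ≤ ‖M‖ * ‖χ 0‖ := M.le_opNorm _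
  calc ‖χ t‖ ≤ √d * (κ ^ (d - 1) * (K * ‖M (χ t)‖)) := hx _
    _ ≤ √d * (κ ^ (d - 1) * (K * (‖M‖ * ‖χ 0‖ * Real.exp (-(α * κ / 4) * t) +
          2 * B * cb / α * Γ))) := by
        gcongr
        exact h2.trans (by gcongr)
    _ ≤ _ := by
        have p1 : 0 ≤ √d * κ ^ (d - 1) * K * (‖M‖ * Γ) := by positivity
        have p2 : 0 ≤ √d * κ ^ (d - 1) * K * (2 * B * cb / α *
          (Real.exp (-(α * κ / 4) * t) * ‖χ 0‖)) := by positivity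
        change _ ≤ √d * κ ^ (d - 1) * K * (‖M‖ + 2 * B * cb / α) *
          (Real.exp (-(α * κ / 4) * t) * ‖χ 0‖ + Γ)
        linarith

end Observer

/-! ### High-gain feedback around an exponentially stable set: globally Lipschitz fields -/

section HighGain

variable {X : Type*} [NormedAddCommGroup X] [NormedSpace ℝ X]

/-- The system `ṗ = F(p, e)`, `ė = H(p, e) - k e + u(t)`, where `g = (F, H)`. -/
def highGainField (g : X × ℝ → X × ℝ) (k : ℝ) (u : ℝ → ℝ) (t : ℝ) (x : X × ℝ) : X × ℝ :=
  ((g x).1, (g x).2 - k * x.2 + u t)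

theorem _root_.HasDerivWithinAt.prod_fst {E F : Type*} [NormedAddCommGroup E] [NormedSpace ℝ E]
    [NormedAddCommGroup F] [NormedSpace ℝ F] {x : ℝ → E × F} {x' : E × F} {s : Set ℝ} {t : ℝ}
    (h : HasDerivWithinAt x x' s t) : HasDerivWithinAt (fun t => (x t).1) x'.1 s t :=
  (ContinuousLinearMap.fst ℝ E F).hasFDerivAt.comp_hasDerivWithinAt t h

theorem _root_.HasDerivWithinAt.prod_snd {E F : Type*} [NormedAddCommGroup E] [NormedSpace ℝ E]
    [NormedAddCommGroup F] [NormedSpace ℝ F] {x : ℝ → E × F} {x' : E × F} {s : Set ℝ} {t : ℝ}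
    (h : HasDerivWithinAt x x' s t) : HasDerivWithinAt (fun t => (x t).2) x'.2 s t :=
  (ContinuousLinearMap.snd ℝ E F).hasFDerivAt.comp_hasDerivWithinAt t h

theorem dist_prod_le_add {Y : Type*} [PseudoMetricSpace Y] (p q : Y) (a b : ℝ) :
    dist (p, a) (q, b) ≤ dist p q + |a - b| := by
  rw [Prod.dist_eq, Real.dist_eq]
  exact max_le (le_add_of_nonneg_right (abs_nonneg _)) (le_add_of_nonneg_left dist_nonneg)

/-- If `|H(p, e)| ≤ L |e| + D` along the solution, then for `k > L` the error `e` decays with rate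
`k - L` up to `(D + U) / (k - L)`. -/
theorem abs_snd_le_of_isSolution {g : X × ℝ → X × ℝ} {k L D U T : ℝ} {u : ℝ → ℝ} {x : ℝ → X × ℝ}
    (hx : IsSolution (highGainField g k u) x) (hk : L < k) (hD : 0 ≤ D) (hU : 0 ≤ U)
    (hg : ∀ t ∈ Icc 0 T, |(g (x t)).2| ≤ L * |(x t).2| + D) (hu : ∀ t ∈ Icc 0 T, |u t| ≤ U) :
    ∀ t ∈ Icc 0 T, |(x t).2| ≤ |(x 0).2| * Real.exp (-(k - L) * t) + (D + U) / (k - L) := by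
  have hc : ContinuousOn (fun t => (x t).2) (Icc 0 T) :=
    continuous_snd.comp_continuousOn (hx.continuousOn.mono Icc_subset_Ici_self)
  have hd : ∀ t ∈ Ico 0 T, HasDerivWithinAt (fun t => (x t).2)
      ((g (x t)).2 - k * (x t).2 + u t) (Ici t) t := fun t ht =>
    (hx.hasDerivWithinAt_Ici ht.1).prod_snd
  intro t ht
  refine abs_le'.2 ⟨?_, ?_⟩
  · refine le_exp_add_of_deriv_le (by linarith) (by positivity) (abs_nonneg _) hc hd
      (le_abs_self _) (fun s hs h0 => ?_) t ht
    have h1 := (le_abs_self _).trans (hg s (Ico_subset_Icc_self hs))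
    have h2 := (le_abs_self _).trans (hu s (Ico_subset_Icc_self hs))
    rw [abs_of_nonneg h0] at h1
    linarith
  · refine le_exp_add_of_deriv_le (f := fun t => -(x t).2) (by linarith) (by positivity)
      (abs_nonneg _) hc.neg (fun s hs => (hd s hs).neg) (neg_le_abs _) (fun s hs h0 => ?_) t ht
    have h1 := (neg_le_abs _).trans (hg s (Ico_subset_Icc_self hs))
    have h2 := (neg_le_abs _).trans (hu s (Ico_subset_Icc_self hs))
    rw [← abs_neg (x s).2, abs_of_nonneg h0] at h1
    linarith

theorem abs_snd_le_infDist {X : Type*} [NormedAddCommGroup X] {g : X × ℝ → X × ℝ} {L : NNReal}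
    (hg : LipschitzWith L g) {A : Set X} (hA : IsCompact A) (hne : A.Nonempty)
    (hA0 : ∀ a ∈ A, (g (a, 0)).2 = 0) (p : X) (e : ℝ) :
    |(g (p, e)).2| ≤ L * |e| + L * Metric.infDist p A := by
  obtain ⟨a, ha, hpa⟩ := hA.exists_infDist_eq_dist hne p
  have h1 : dist (g (p, e)).2 (g (a, 0)).2 ≤ L * dist (p, e) (a, 0) :=
    (LipschitzWith.prod_snd.dist_le_mul _ _).trans (by simpa using hg.dist_le_mul _ _)
  rw [hA0 a ha, Real.dist_eq, sub_zero] at h1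
  have h2 := dist_prod_le_add p a e 0
  rw [sub_zero] at h2
  calc _ ≤ _ := h1
    _ ≤ L * (dist p a + |e|) := by gcongr
    _ = _ := by rw [hpa]; ring

/-- Over a time interval of length `T` the `p`-component stays close to the solution of
`ṗ = F(p, 0)` with the same initial state, linearly in `sup |e|`. -/
theorem dist_nominal_le {g : X × ℝ → X × ℝ} {L : NNReal} (hg : LipschitzWith L g) (hL : 1 ≤ L)
    {k T E : ℝ} {u : ℝ → ℝ} {x : ℝ → X × ℝ} {p : ℝ → X} (hx : IsSolution (highGainField g k u) x)
    (hp : IsSolution (fun _ p => (g (p, 0)).1) p) (h0 : p 0 = (x 0).1) (hE0 : 0 ≤ E)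
    (hE : ∀ t ∈ Icc 0 T, |(x t).2| ≤ E) :
    ∀ t ∈ Icc 0 T, dist (x t).1 (p t) ≤ Real.exp (L * T) * E := by
  have hL0 : (0 : ℝ) < L := by
    have : (1 : ℝ) ≤ L := by exact_mod_cast hL
    linarith
  have hv : ∀ _ : ℝ, LipschitzWith L (fun q : X => (g (q, 0)).1) := fun _ =>
    LipschitzWith.of_dist_le_mul fun q q' => by
      refine (LipschitzWith.prod_fst.dist_le_mul _ _).trans ?_
      have := hg.dist_le_mul (q, 0) (q', 0)
      rw [Prod.dist_eq (x := (q, (0 : ℝ)))] at this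
      simpa using this
  intro t ht
  have h1 := dist_le_of_approx_trajectories_ODE (εf := L * E) (εg := 0) (δ := 0) hv
    (continuous_fst.comp_continuousOn (hx.continuousOn.mono Icc_subset_Ici_self))
    (fun s hs => (hx.hasDerivWithinAt_Ici hs.1).prod_fst) (fun s hs => ?_)
    (hp.continuousOn.mono (Icc_subset_Ici_self : Icc 0 T ⊆ _))
    (fun s hs => hp.hasDerivWithinAt_Ici hs.1) (fun s _ => (dist_self _).le)
    (by simp [h0]) t ht
  · refine h1.trans ?_
    rw [gronwallBound_of_K_ne_0 hL0.ne']
    beta_reduce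
    rw [zero_mul, zero_add, add_zero, sub_zero,
      mul_div_cancel_left₀ _ hL0.ne', mul_comm]
    gcongr
    have : Real.exp (L * t) ≤ Real.exp (L * T) := by gcongr; exact ht.2
    linarith
  · have h2 : dist (g (x s)).1 (g ((x s).1, 0)).1 ≤ L * dist (x s) ((x s).1, 0) :=
      (LipschitzWith.prod_fst.dist_le_mul _ _).trans (by simpa using hg.dist_le_mul _ _)
    have h3 := dist_prod_le_add (x s).1 (x s).1 (x s).2 0
    rw [dist_self, zero_add, sub_zero] at h3
    refine h2.trans ?_
    gcongr
    exact h3.trans (hE s (Ico_subset_Icc_self hs))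

/-- Small gain: if the nominal system `ṗ = F(p, 0)` halves the distance to `A` in time `T`, then
for large `k` the quantity `|p|_A + ρ |e|` contracts by the factor `3 / 4` in time `T`, up to a
multiple of the disturbance bound `U`. -/
theorem exists_window_contraction {g : X × ℝ → X × ℝ} {L : NNReal} (hg : LipschitzWith L g)
    (hL : 1 ≤ L) {A : Set X} (hA : IsCompact A) (hne : A.Nonempty)
    (hA0 : ∀ a ∈ A, (g (a, 0)).2 = 0) {T M : ℝ} (hT : 0 < T) (hM : 0 ≤ M) :
    ∃ ρ > 0, ∃ C ≥ 1, ∃ k₁ : ℝ, ∀ k > k₁, ∀ (u : ℝ → ℝ) (U : ℝ) (x : ℝ → X × ℝ) (p : ℝ → X),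
      0 ≤ U → IsSolution (highGainField g k u) x → (∀ t, 0 ≤ t → |u t| ≤ U) →
      IsSolution (fun _ p => (g (p, 0)).1) p → p 0 = (x 0).1 →
      (∀ t ∈ Icc 0 T, Metric.infDist (p t) A ≤ M * Metric.infDist (p 0) A) →
      Metric.infDist (p T) A ≤ 1 / 2 * Metric.infDist (p 0) A →
      Metric.infDist (x T).1 A + ρ * |(x T).2| ≤
          3 / 4 * (Metric.infDist (x 0).1 A + ρ * |(x 0).2|) + C * U ∧
        ∀ t ∈ Icc 0 T, Metric.infDist (x t).1 A + |(x t).2| ≤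
          C * (Metric.infDist (x 0).1 A + ρ * |(x 0).2| + U) := by
  have hL1 : (1 : ℝ) ≤ L := by exact_mod_cast hL
  set c : ℝ := Real.exp (L * T) with hc
  have hc1 : 1 ≤ c := Real.one_le_exp (by positivity)
  -- the weight `ρ = 4 c` makes the influence `2 c |e(0)|` of the error on `p` half of `ρ |e(0)|`
  set β₁ : ℝ := 1 + 4 * (1 / T + 2 * (L * c)) + 40 * (c * (L * M)) with hβ₁
  refine ⟨4 * c, by positivity, M + 4 * (c * (L * M)) + 10 * c, ?_, L + β₁,
    fun k hk u U x p hU hx hu hp h0 hpM hpT => ?_⟩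
  · have : 0 ≤ 4 * (c * (L * M)) := by positivity
    linarith
  set β : ℝ := k - L with hβ
  have hβ₁β : β₁ < β := by linarith
  have hβ₁0 : 0 < β₁ := by positivity
  have hβ0 : 0 < β := by linarith
  set s : ℝ := 1 / β with hs
  have hs0 : 0 < s := by positivity
  have hs1 : s * β₁ ≤ 1 := by
    rw [hs, one_div_mul_eq_div, div_le_one hβ0]; exact hβ₁β.le
  have q1 : 0 ≤ s * (1 / T) := by positivity
  have q2 : 0 ≤ s * (L * c) := by positivity
  have q3 : 0 ≤ s * (c * (L * M)) := by positivity
  have hs1' : s + 4 * (s * (1 / T)) + 8 * (s * (L * c)) + 40 * (s * (c * (L * M))) ≤ 1 := by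
    rw [hβ₁] at hs1; linarith
  -- `E` is the largest error on `[0, T]`
  obtain ⟨tm, htm, hmax⟩ := isCompact_Icc.exists_isMaxOn (nonempty_Icc.2 hT.le)
    (f := fun t => |(x t).2|) (continuous_snd.comp_continuousOn
      (hx.continuousOn.mono (Icc_subset_Ici_self : Icc 0 T ⊆ _))).abs
  set E : ℝ := |(x tm).2| with hE
  have hE0 : 0 ≤ E := abs_nonneg _
  have hEt : ∀ t ∈ Icc 0 T, |(x t).2| ≤ E := fun t ht => hmax ht
  set δ₀ : ℝ := Metric.infDist (x 0).1 A with hδ₀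
  have hδ₀0 : 0 ≤ δ₀ := Metric.infDist_nonneg
  set e₀ : ℝ := |(x 0).2| with he₀
  have he₀0 : 0 ≤ e₀ := abs_nonneg _
  rw [h0, ← hδ₀] at hpM hpT
  have hdist := dist_nominal_le hg hL hx hp h0 hE0 hEt
  have hδ : ∀ t ∈ Icc 0 T, Metric.infDist (x t).1 A ≤ Metric.infDist (p t) A + c * E := fun t ht =>
    Metric.infDist_le_infDist_add_dist.trans (by gcongr; exact hdist t ht)
  have herr := abs_snd_le_of_isSolution (L := L) (D := L * (M * δ₀ + c * E)) (U := U) (T := T) hx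
    (by linarith) (by positivity) hU (fun t ht => by
      refine (abs_snd_le_infDist hg hA hne hA0 (x t).1 (x t).2).trans ?_
      gcongr
      exact (hδ t ht).trans (by gcongr; exact hpM t ht)) (fun t ht => hu t ht.1)
  rw [← hβ, ← he₀] at herr
  have hfrac : (L * (M * δ₀ + c * E) + U) / β = s * (L * M) * δ₀ + s * (L * c) * E + s * U := by
    rw [hs]; field_simp
  rw [hfrac] at herr
  -- solving the small-gain inequality for `E`
  have hE2 : E ≤ 2 * e₀ + 2 * (s * (L * M) * δ₀ + s * U) := by
    have h1 := herr tm htm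
    have h2 : Real.exp (-β * tm) ≤ 1 := Real.exp_le_one_iff.2 (by nlinarith [htm.1])
    have h3 : e₀ * Real.exp (-β * tm) ≤ e₀ := mul_le_of_le_one_right he₀0 h2
    have h4 : s * (L * c) * E ≤ 1 / 2 * E := by
      gcongr; linarith
    linarith
  have hexp : Real.exp (-β * T) ≤ s * (1 / T) := by
    rw [neg_mul, Real.exp_neg, hs, one_div_mul_one_div, inv_eq_one_div]
    refine one_div_le_one_div_of_le (by positivity) ?_
    linarith [Real.add_one_le_exp (β * T)]
  have hcE : c * E ≤ 2 * c * e₀ + 2 * (s * (c * (L * M))) * δ₀ + 2 * (s * c) * U := by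
    have := mul_le_mul_of_nonneg_left hE2 (by positivity : 0 ≤ c)
    linarith
  have hs1le : s ≤ 1 := by linarith
  constructor
  · have h1 := hδ T ⟨hT.le, le_rfl⟩
    have h2 := herr T ⟨hT.le, le_rfl⟩
    have h3 : e₀ * Real.exp (-β * T) ≤ e₀ * (s * (1 / T)) := by gcongr
    have h4 : s * (L * c) * E ≤
        2 * (s * (L * c)) * e₀ + 1 * (s * (L * M) * δ₀ + s * U) := by
      have := mul_le_mul_of_nonneg_left hE2 q2
      have h5 : 2 * (s * (L * c)) * (s * (L * M) * δ₀ + s * U) ≤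
          1 * (s * (L * M) * δ₀ + s * U) := by
        gcongr; linarith
      linarith
    have h6 : |(x T).2| ≤ (s * (1 / T) + 2 * (s * (L * c))) * e₀ +
        2 * (s * (L * M)) * δ₀ + 2 * s * U := by linarith
    have h7 := mul_le_mul_of_nonneg_left h6 (by positivity : 0 ≤ 4 * c)
    have h8 : (4 * c) * ((s * (1 / T) + 2 * (s * (L * c))) * e₀) ≤ c * e₀ := by
      have : (4 * (s * (1 / T) + 2 * (s * (L * c)))) * (c * e₀) ≤ 1 * (c * e₀) := by
        gcongr; linarith
      linarith
    have h9 : 10 * (s * (c * (L * M))) * δ₀ ≤ 1 / 4 * δ₀ := by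
      gcongr; linarith
    have h10 : 10 * (s * c) * U ≤ 10 * (1 * c) * U := by gcongr
    have h11 : 0 ≤ (M + 4 * (c * (L * M))) * U := by positivity
    linarith
  · intro t ht
    have h1 := hδ t ht
    have h2 := hpM t ht
    have h3 := hEt t ht
    have h4 : E ≤ c * E := le_mul_of_one_le_left hE0 hc1
    have h5 : 4 * (s * (c * (L * M))) * δ₀ ≤ 4 * (1 * (c * (L * M))) * δ₀ := by gcongr
    have h6 : 4 * (s * c) * U ≤ 4 * (1 * c) * U := by gcongr
    have h7 : 0 ≤ 10 * c * δ₀ := by positivity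
    have h8 : 4 * c * e₀ ≤ (M + 4 * (c * (L * M)) + 10 * c) * (4 * c * e₀) := by
      apply le_mul_of_one_le_left (by positivity)
      have : 0 ≤ 4 * (c * (L * M)) := by positivity
      linarith
    have h9 : 0 ≤ (M + 4 * (c * (L * M)) + 6 * c) * U := by positivity
    linarith

/-- The nominal solutions starting in `Ω` within distance `r` of `A` exist, amplify the distance to
`A` at most by the factor `M`, and halve it in time `T`. -/
def NominalContraction (g : X × ℝ → X × ℝ) (A Ω : Set X) (r T M : ℝ) : Prop :=
  ∀ p₀ ∈ Ω, Metric.infDist p₀ A ≤ r → ∃ p : ℝ → X,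
    IsSolution (fun _ p => (g (p, 0)).1) p ∧ p 0 = p₀ ∧
    (∀ t, 0 ≤ t → Metric.infDist (p t) A ≤ M * Metric.infDist p₀ A) ∧
    Metric.infDist (p T) A ≤ 1 / 2 * Metric.infDist p₀ A

/-- Local input-to-state stability of `A × {0}` for the high-gain system, when every nominal
solution that starts in `Ω` close to `A` halves its distance to `A` in time `T`. Membership in `Ω`
is only required as long as the solution stays within distance `1` of `A × {0}`, so that the
statement applies to a field that is truncated outside a ball. -/
theorem exists_local_iss {g : X × ℝ → X × ℝ} {L : NNReal} (hg : LipschitzWith L g)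
    (hL : 1 ≤ L) {A Ω : Set X} (hA : IsCompact A) (hne : A.Nonempty)
    (hA0 : ∀ a ∈ A, (g (a, 0)).2 = 0) {r T M : ℝ} (hr : 0 < r) (hT : 0 < T) (hM : 0 ≤ M)
    (hnom : NominalContraction g A Ω r T M) :
    ∃ C > 0, ∃ r₁ > 0, ∃ k₁ : ℝ, ∀ k > k₁, ∀ (u : ℝ → ℝ) (U : ℝ) (x : ℝ → X × ℝ), 0 ≤ U →
      IsSolution (highGainField g k u) x → (∀ t, 0 ≤ t → |u t| ≤ U) →
      (∀ s, 0 ≤ s → (∀ t ∈ Icc 0 s, Metric.infDist (x t).1 A ≤ 1 ∧ |(x t).2| ≤ 1) →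
        (x s).1 ∈ Ω) →
      Metric.infDist (x 0).1 A + |(x 0).2| + U ≤ r₁ →
      (∀ t, 0 ≤ t → Metric.infDist (x t).1 A + |(x t).2| ≤ 1) ∧
      (∀ t, 0 ≤ t → Metric.infDist (x t).1 A + |(x t).2| ≤
        C * (Metric.infDist (x 0).1 A + |(x 0).2| + U)) ∧
      (U = 0 → Tendsto (fun t => Metric.infDist (x t).1 A + |(x t).2|) atTop (𝓝 0)) := by
  obtain ⟨ρ, hρ, C, hC1, k₁, hwin⟩ := exists_window_contraction hg hL hA hne hA0 hT hM
  have hC0 : 0 < C := by linarith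
  -- the contraction by `3 / 4` with offset `C U` sums up to the offset `4 C U`
  set C' : ℝ := C * (2 + ρ + 4 * C) with hC'
  have hC'0 : 0 < C' := by positivity
  refine ⟨C', hC'0, min 1 (min (r / (1 + ρ + 4 * C)) (1 / C')), by positivity, k₁,
    fun k hk u U x hU hx hu hΩ hsmall => ?_⟩
  set δ : ℝ → ℝ := fun t => Metric.infDist (x t).1 A with hδ
  set e : ℝ → ℝ := fun t => |(x t).2| with he
  have hδ0 : ∀ t, 0 ≤ δ t := fun t => Metric.infDist_nonneg
  have he0 : ∀ t, 0 ≤ e t := fun t => abs_nonneg _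
  set Y : ℝ → ℝ := fun t => δ t + ρ * e t with hY
  have hY0 : ∀ t, 0 ≤ Y t := fun t => add_nonneg (hδ0 t) (mul_nonneg hρ.le (he0 t))
  set N : ℝ := δ 0 + e 0 + U with hN
  have hN0 : 0 ≤ N := add_nonneg (add_nonneg (hδ0 0) (he0 0)) hU
  have hN1 : N ≤ 1 := hsmall.trans (min_le_left _ _)
  have hNr : (1 + ρ + 4 * C) * N ≤ r := by
    have := hsmall.trans ((min_le_right _ _).trans (min_le_left _ _))
    rw [le_div_iff₀ (by positivity)] at this
    linarith
  have hNC : C' * N ≤ 1 := by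
    have := hsmall.trans ((min_le_right _ _).trans (min_le_right _ _))
    rw [le_div_iff₀ (by positivity)] at this
    linarith
  have hYN : Y 0 ≤ (1 + ρ) * N := by
    have h1 := mul_nonneg hρ.le (hδ0 0)
    have h2 := mul_nonneg (by linarith : 0 ≤ 1 + ρ) hU
    have h3 := he0 0
    simp only [hY, hN]
    linarith
  have hpow : ∀ j : ℕ, (3 / 4 : ℝ) ^ j * Y 0 ≤ Y 0 := fun j =>
    mul_le_of_le_one_left (hY0 0) (pow_le_one₀ (by norm_num) (by norm_num))
  have hjN : ∀ j : ℕ, (3 / 4 : ℝ) ^ j * Y 0 + 4 * C * U ≤ (1 + ρ + 4 * C) * N := fun j => by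
    have h1 := hpow j
    have h2 : 4 * C * U ≤ 4 * C * N := by
      gcongr
      have := hδ0 0
      have := he0 0
      simp only [hN]; linarith
    linarith
  have hUN : U ≤ N := by
    have := hδ0 0
    have := he0 0
    simp only [hN]; linarith
  have hcell : ∀ j : ℕ, C * ((3 / 4 : ℝ) ^ j * Y 0 + 4 * C * U + U) ≤ C' * N := fun j => by
    have h1 := mul_le_mul_of_nonneg_left (add_le_add (hjN j) hUN) hC0.le
    rw [hC']
    linarith
  have hstep : ∀ j : ℕ, (∀ t ∈ Icc 0 (j * T), δ t ≤ 1 ∧ e t ≤ 1) →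
      Y (j * T) ≤ (3 / 4 : ℝ) ^ j * Y 0 + 4 * C * U →
      Y (j * T + T) ≤ 3 / 4 * Y (j * T) + C * U ∧ ∀ t ∈ Icc (j * T) (j * T + T),
        δ t + e t ≤ C * ((3 / 4 : ℝ) ^ j * Y 0 + 4 * C * U + U) := by
    intro j hnear hYj
    have hj0 : 0 ≤ j * T := by positivity
    have hmem := hΩ _ hj0 hnear
    have hδr : δ (j * T) ≤ r := by
      have h1 := hjN j
      have h2 := mul_nonneg hρ.le (he0 (j * T))
      simp only [hY] at hYj
      linarith
    obtain ⟨p, hp, hp0, hpM, hpT⟩ := hnom _ hmem hδr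
    have hx' : IsSolution (highGainField g k fun t => u (j * T + t)) fun t => x (j * T + t) :=
      hx.shift hj0
    have := hwin k hk _ U _ p hU hx' (fun t ht => hu _ (by positivity)) hp
      (by simpa using hp0) (fun t ht => by rw [hp0]; exact hpM t ht.1) (by rw [hp0]; exact hpT)
    simp only [add_zero] at this
    refine ⟨this.1, fun t ht => ?_⟩
    have h1 := this.2 (t - j * T) ⟨by linarith [ht.1], by linarith [ht.2]⟩
    rw [add_sub_cancel] at h1
    refine h1.trans ?_
    gcongr
  have hδe : ∀ t, δ t + e t ≤ 1 → δ t ≤ 1 ∧ e t ≤ 1 := fun t ht =>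
    ⟨by linarith [he0 t], by linarith [hδ0 t]⟩
  have hind : ∀ j : ℕ, (∀ t ∈ Icc 0 (j * T), δ t ≤ 1 ∧ e t ≤ 1) ∧
      Y (j * T) ≤ (3 / 4 : ℝ) ^ j * Y 0 + 4 * C * U := by
    intro j
    induction j with
    | zero =>
      refine ⟨fun t ht => ?_, ?_⟩
      · obtain rfl : t = 0 := by simpa using ht
        exact hδe 0 (by linarith)
      · have : 0 ≤ 4 * C * U := by positivity
        simpa using this
    | succ j ih =>
      obtain ⟨h1, h2⟩ := hstep j ih.1 ih.2
      have e1 : ((j + 1 : ℕ) : ℝ) * T = j * T + T := by push_cast; ring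
      rw [e1]
      refine ⟨fun t ht => ?_, ?_⟩
      · rcases le_total t (j * T) with h3 | h3
        · exact ih.1 t ⟨ht.1, h3⟩
        · exact hδe t ((h2 t ⟨h3, ht.2⟩).trans ((hcell j).trans hNC))
      · rw [pow_succ]
        linarith [ih.2]
  have hall : ∀ t, 0 ≤ t → δ t + e t ≤ C * ((3 / 4 : ℝ) ^ ⌊t / T⌋₊ * Y 0 + 4 * C * U + U) := by
    intro t ht
    refine (hstep _ (hind _).1 (hind _).2).2 t ⟨?_, ?_⟩
    · rw [← le_div_iff₀ hT]; exact Nat.floor_le (by positivity)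
    · have := Nat.lt_floor_add_one (t / T)
      rw [div_lt_iff₀ hT] at this
      linarith
  refine ⟨fun t ht => (hall t ht).trans ((hcell _).trans hNC),
    fun t ht => (hall t ht).trans (hcell _), fun hU0 => ?_⟩
  have hlim : Tendsto (fun t : ℝ => C * ((3 / 4 : ℝ) ^ ⌊t / T⌋₊ * Y 0 + 4 * C * U + U)) atTop
      (𝓝 0) := by
    have h1 : Tendsto (fun t : ℝ => ⌊t / T⌋₊) atTop atTop :=
      tendsto_nat_floor_atTop.comp (tendsto_id.atTop_div_const hT)
    have h2 := (tendsto_pow_atTop_nhds_zero_of_lt_one (by norm_num : (0 : ℝ) ≤ 3 / 4)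
      (by norm_num)).comp h1
    have h3 := (h2.mul_const (Y 0)).const_mul C
    simpa [hU0] using h3
  refine squeeze_zero' (Eventually.of_forall fun t => add_nonneg (hδ0 t) (he0 t)) ?_ hlim
  filter_upwards [eventually_ge_atTop 0] with t ht using hall t ht

/-- Over a fixed time interval `[0, T]` and for large `k` the `p`-component follows a nominal
solution, and the error, initially of any size at most `c`, becomes small. -/
theorem exists_transient_bound {g : X × ℝ → X × ℝ} {L : NNReal} (hg : LipschitzWith L g)
    {B : ℝ} (hB : ∀ x, ‖g x‖ ≤ B) {p : ℝ → X} (hp : IsSolution (fun _ p => (g (p, 0)).1) p)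
    {T c η : ℝ} (hT : 0 < T) (hc : 0 ≤ c) (hη : 0 < η) :
    ∃ σ > 0, ∃ k₁ : ℝ, ∀ k > k₁, ∀ x : ℝ → X × ℝ, IsSolution (highGainField g k fun _ => 0) x →
      dist (x 0).1 (p 0) ≤ σ → |(x 0).2| ≤ c →
      (∀ t ∈ Icc 0 T, dist (x t).1 (p t) ≤ η ∧ |(x t).2| ≤ c + 1) ∧ |(x T).2| ≤ η := by
  have hB0 : 0 ≤ B := (norm_nonneg _).trans (hB 0)
  set m : ℝ := Real.exp ((L + 1) * T) with hm
  have hm0 : 0 < m := Real.exp_pos _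
  refine ⟨η / (2 * m), by positivity, 1 + B + 4 * L * (c + B) * m / η + (c / T + B) / η,
    fun k hk x hx h0 he0 => ?_⟩
  have r1 : 0 ≤ 4 * L * (c + B) * m / η := by positivity
  have r2 : 0 ≤ (c / T + B) / η := by positivity
  have hk0 : 0 < k := by linarith
  have herr : ∀ t ∈ Icc 0 T, |(x t).2| ≤ c * Real.exp (-k * t) + B / k := by
    intro t ht
    have h1 := abs_snd_le_of_isSolution (L := 0) (D := B) (U := 0) (T := T) hx hk0 hB0 le_rfl
      (fun t _ => by
        have : ‖(g (x t)).2‖ ≤ B := (norm_snd_le _).trans (hB _)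
        simpa using this) (fun t _ => by simp) t ht
    rw [sub_zero, add_zero] at h1
    refine h1.trans ?_
    gcongr
  have hBk : B / k ≤ 1 := by
    rw [div_le_one hk0]; linarith
  -- the comparison function integrates the decaying bound on `|e|`
  set b : ℝ → ℝ := fun t => Real.exp ((L + 1) * t) *
    (η / (2 * m) + 2 * L * c / k * (1 - Real.exp (-k * t)) + 2 * L * B / k) with hb
  have hbd : ∀ t, HasDerivAt b ((L + 1) * b t +
      Real.exp ((L + 1) * t) * (2 * L * c * Real.exp (-k * t))) t := by
    intro t
    have h1 : HasDerivAt (fun t : ℝ => Real.exp ((L + 1) * t))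
        (Real.exp ((L + 1) * t) * (L + 1)) t := by
      simpa using ((hasDerivAt_id t).const_mul ((L : ℝ) + 1)).exp
    have h2 : HasDerivAt (fun t : ℝ => Real.exp (-k * t)) (Real.exp (-k * t) * -k) t := by
      simpa using ((hasDerivAt_id t).const_mul (-k)).exp
    have h3 := h1.mul ((((h2.const_sub 1).const_mul (2 * L * c / k)).const_add
      (η / (2 * m))).add_const (2 * L * B / k))
    refine h3.congr_deriv ?_
    simp only [hb]
    field_simp
  have hfence : ∀ ⦃t⦄, t ∈ Icc 0 T → ‖(x t).1 - p t‖ ≤ b t := by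
    refine image_norm_le_of_norm_deriv_right_lt_deriv_boundary
      (f' := fun t => (g (x t)).1 - (g (p t, 0)).1) ?_ (fun t ht => ?_) ?_ hbd ?_
    · exact (continuous_fst.comp_continuousOn (hx.continuousOn.mono Icc_subset_Ici_self)).sub
        (hp.continuousOn.mono Icc_subset_Ici_self)
    · exact (hx.hasDerivWithinAt_Ici ht.1).prod_fst.sub (hp.hasDerivWithinAt_Ici ht.1)
    · rw [← dist_eq_norm]
      have : 0 ≤ 2 * L * B / k := by positivity
      simp only [hb, mul_zero, Real.exp_zero, sub_self]
      linarith
    · intro t ht heq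
      have h1 : ‖(g (x t)).1 - (g (p t, 0)).1‖ ≤ L * dist (x t) (p t, 0) := by
        rw [← dist_eq_norm]
        exact (LipschitzWith.prod_fst.dist_le_mul _ _).trans (by simpa using hg.dist_le_mul _ _)
      have h2 := dist_prod_le_add (x t).1 (p t) (x t).2 0
      rw [sub_zero, dist_eq_norm (x t).1, heq] at h2
      have h3 := herr t (Ico_subset_Icc_self ht)
      have h4 : 1 ≤ Real.exp ((L + 1) * t) := Real.one_le_exp (mul_nonneg (by positivity) ht.1)
      have h5 : Real.exp (-k * t) ≤ 1 := Real.exp_le_one_iff.2 (by nlinarith [ht.1])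
      have h6 : η / (2 * m) + 2 * L * B / k ≤ b t := by
        have h7 : 0 ≤ 2 * L * c / k * (1 - Real.exp (-k * t)) :=
          mul_nonneg (by positivity) (by linarith)
        have h8 : 0 ≤ η / (2 * m) + 2 * L * c / k * (1 - Real.exp (-k * t)) + 2 * L * B / k := by
          positivity
        have h9 := mul_le_mul_of_nonneg_right h4 h8
        simp only [hb]
        linarith
      have h7 : 2 * L * c * Real.exp (-k * t) ≤
          Real.exp ((L + 1) * t) * (2 * L * c * Real.exp (-k * t)) :=
        le_mul_of_one_le_left (by positivity) h4
      have h8 : (L : ℝ) * dist (x t) (p t, 0) ≤ L * (b t + (c * Real.exp (-k * t) + B / k)) := by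
        gcongr
        exact h2.trans (by gcongr)
      have h9 : 0 < η / (2 * m) := by positivity
      have h10 : 0 ≤ 2 * L * B / k := by positivity
      have h11 : 0 ≤ L * c * Real.exp (-k * t) := by positivity
      have h12 : 2 * L * B / k = 2 * (L * (B / k)) := by ring
      calc _ ≤ _ := h1
        _ ≤ _ := h8
        _ < _ := by linarith
  have hbη : ∀ t ∈ Icc 0 T, b t ≤ η := by
    intro t ht
    have h1 : Real.exp ((L + 1) * t) ≤ m := by
      rw [hm]; gcongr; exact ht.2
    have h2 : 2 * L * c / k * (1 - Real.exp (-k * t)) ≤ 2 * L * c / k :=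
      mul_le_of_le_one_right (by positivity) (by linarith [Real.exp_pos (-k * t)])
    have h3 : 0 ≤ 1 - Real.exp (-k * t) := by
      have : Real.exp (-k * t) ≤ 1 := Real.exp_le_one_iff.2 (by nlinarith [ht.1])
      linarith
    have h4 : 4 * L * (c + B) * m ≤ k * η := by
      rw [← div_le_iff₀ hη]; linarith
    calc b t ≤ m * (η / (2 * m) + 2 * L * c / k + 2 * L * B / k) := by
          simp only [hb]; gcongr
      _ = η / 2 + 4 * L * (c + B) * m / k / 2 := by field_simp; ring
      _ ≤ η / 2 + η / 2 := by
          gcongr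
          rw [div_le_iff₀ hk0]; linarith
      _ = η := by ring
  refine ⟨fun t ht => ⟨?_, ?_⟩, ?_⟩
  · rw [dist_eq_norm]; exact (hfence ht).trans (hbη t ht)
  · have h5 : Real.exp (-k * t) ≤ 1 := Real.exp_le_one_iff.2 (by nlinarith [ht.1])
    exact (herr t ht).trans (add_le_add (mul_le_of_le_one_right hc h5) hBk)
  · refine (herr T ⟨hT.le, le_rfl⟩).trans ?_
    have h1 : Real.exp (-k * T) ≤ 1 / (k * T) := by
      rw [neg_mul, Real.exp_neg, inv_eq_one_div]
      exact one_div_le_one_div_of_le (by positivity) (by linarith [Real.add_one_le_exp (k * T)])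
    calc c * Real.exp (-k * T) + B / k ≤ c * (1 / (k * T)) + B / k := by gcongr
      _ = (c / T + B) / k := by field_simp
      _ ≤ η := by
        rw [div_le_iff₀ hk0, mul_comm, ← div_le_iff₀ hη]
        linarith

end HighGain

/-! ### High-gain feedback: locally Lipschitz fields -/

section HighGainLocallyLipschitz

variable {X : Type*} [NormedAddCommGroup X] [NormedSpace ℝ X]

theorem exists_isSolution_highGainField [CompleteSpace X] {g : X × ℝ → X × ℝ} {L : NNReal}
    (hg : LipschitzWith L g) (k : ℝ) {u : ℝ → ℝ} (hu : ContinuousOn u (Ici 0)) (x₀ : X × ℝ) :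
    ∃ x, IsSolution (highGainField g k u) x ∧ x 0 = x₀ := by
  have hu' : Continuous fun t => u (max t 0) :=
    hu.comp_continuous (by fun_prop) fun t => le_max_right t 0
  have hK : ∀ t, LipschitzWith (max (1 * L) (1 * L + ‖k‖₊ * 1 + 0))
      (highGainField g k (fun t => u (max t 0)) t) := fun t =>
    (LipschitzWith.prod_fst.comp hg).prodMk (((LipschitzWith.prod_snd.comp hg).sub
      ((lipschitzWith_smul k).comp LipschitzWith.prod_snd)).add (LipschitzWith.const _))
  obtain ⟨x, hx, hx0⟩ := exists_isSolution hK (fun x =>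
    continuous_const.prodMk (continuous_const.add hu')) x₀
  exact ⟨x, hx.congr fun t ht => by simp only [highGainField, max_eq_left ht], hx0⟩

theorem isSolution_highGainField_eqOn [ProperSpace X] {g : X × ℝ → X × ℝ} (hg : LocallyLipschitz g)
    {k : ℝ} {u : ℝ → ℝ} {x y : ℝ → X × ℝ} (hx : IsSolution (highGainField g k u) x)
    (hy : IsSolution (highGainField g k u) y) (h0 : x 0 = y 0) : EqOn x y (Ici 0) := by
  have hv : LocallyLipschitz fun x : X × ℝ => ((g x).1, (g x).2 - k * x.2) := by
    have h1 : LocallyLipschitz fun x : X × ℝ => k * x.2 :=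
      (((lipschitzWith_smul k).comp LipschitzWith.prod_snd)).locallyLipschitz
    exact (LipschitzWith.prod_fst.locallyLipschitz.comp hg).prodMk
      ((LipschitzWith.prod_snd.locallyLipschitz.comp hg).sub h1)
  have e : ∀ (t : ℝ) (x : X × ℝ), highGainField g k u t x =
      ((g x).1, (g x).2 - k * x.2) + (0, u t) := fun t x => by simp [highGainField]
  exact IsSolution.eqOn hv (g := fun t => (0, u t)) (hx.congr fun t _ => e t _)
    (hy.congr fun t _ => e t _) h0

/-- `Ω` is invariant in forward time for the `p`-component of the high-gain system, for every gain
and every disturbance. -/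
def HighGainInvariant (g : X × ℝ → X × ℝ) (Ω : Set X) : Prop :=
  ∀ (k : ℝ) (u : ℝ → ℝ) (x : ℝ → X × ℝ) (s : ℝ), 0 ≤ s → ContinuousOn x (Icc 0 s) →
    (∀ t ∈ Ico 0 s, HasDerivWithinAt x (highGainField g k u t (x t)) (Ici t) t) →
    (x 0).1 ∈ Ω → (x s).1 ∈ Ω

/-- A solution of a truncated system stays in the invariant set `Ω` for as long as it has not left
the ball on which the truncation changes nothing. -/
theorem HighGainInvariant.mem_of_eq_on_ball {g g' : X × ℝ → X × ℝ} {Ω : Set X}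
    (hΩ : HighGainInvariant g Ω) {R : ℝ} (hgg' : ∀ x, ‖x‖ ≤ R → g' x = g x) {k : ℝ} {u : ℝ → ℝ}
    {x : ℝ → X × ℝ} (hx : IsSolution (highGainField g' k u) x) (h0 : (x 0).1 ∈ Ω) {s : ℝ}
    (hs : 0 ≤ s) (hR : ∀ t ∈ Icc 0 s, ‖x t‖ ≤ R) : (x s).1 ∈ Ω := by
  refine hΩ k u x s hs (hx.continuousOn.mono Icc_subset_Ici_self) (fun t ht => ?_) h0
  have h1 := hx.hasDerivWithinAt_Ici ht.1
  simp only [highGainField, hgg' _ (hR t (Ico_subset_Icc_self ht))] at h1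
  exact h1

theorem exists_bound_of_infDist_le {X : Type*} [NormedAddCommGroup X] {A : Set X}
    (hA : IsCompact A) (hne : A.Nonempty) :
    ∃ RA ≥ 1, ∀ p, Metric.infDist p A ≤ 1 → ‖p‖ ≤ RA := by
  obtain ⟨B, hB⟩ := hA.isBounded.exists_norm_le
  refine ⟨max 1 (B + 1), le_max_left _ _, fun p hp => ?_⟩
  obtain ⟨a, ha, hpa⟩ := hA.exists_infDist_eq_dist hne p
  have h1 : ‖p‖ ≤ ‖a‖ + dist p a := by rw [dist_eq_norm]; exact norm_le_insert' _ _
  have := hB a ha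
  exact le_trans (by linarith) (le_max_right _ _)

theorem exists_norm_bound_of_tendsto_infDist {X : Type*} [NormedAddCommGroup X] {A : Set X}
    (hA : IsCompact A) (hne : A.Nonempty) {p : ℝ → X} (hp : ContinuousOn p (Ici 0))
    (hlim : Tendsto (fun t => Metric.infDist (p t) A) atTop (𝓝 0)) :
    ∃ R, ∀ t, 0 ≤ t → ‖p t‖ ≤ R := by
  obtain ⟨RA, -, hRA⟩ := exists_bound_of_infDist_le hA hne
  obtain ⟨t₀, ht₀⟩ := eventually_atTop.1 (hlim.eventually_le_const one_pos)
  obtain ⟨R, hR⟩ := (isCompact_Icc (a := (0 : ℝ)) (b := t₀)).exists_bound_of_continuousOn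
    (hp.mono Icc_subset_Ici_self)
  refine ⟨max R RA, fun t ht => ?_⟩
  rcases le_total t t₀ with h | h
  · exact (hR t ⟨ht, h⟩).trans (le_max_left _ _)
  · exact (hRA _ (ht₀ t h)).trans (le_max_right _ _)

/-- The local stability estimate for a globally Lipschitz field that agrees with `g` on a ball
containing the unit neighbourhood of `A × {0}`. -/
theorem exists_local_iss_of_eq_on_ball {g g' : X × ℝ → X × ℝ} {A Ω : Set X} (hA : IsCompact A)
    (hne : A.Nonempty) (hA0 : ∀ a ∈ A, (g (a, 0)).2 = 0) (hΩ : HighGainInvariant g Ω)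
    {r T M : ℝ} (hr : 0 < r) (hT : 0 < T) (hM : 0 ≤ M) (hMr : M * r ≤ 1)
    (hnom : NominalContraction g A Ω r T M) {RA R : ℝ} (hRA1 : 1 ≤ RA)
    (hRA : ∀ p, Metric.infDist p A ≤ 1 → ‖p‖ ≤ RA) (hR : RA ≤ R) {L : NNReal}
    (hg' : LipschitzWith L g') (hL : 1 ≤ L) (hgg' : ∀ x, ‖x‖ ≤ R → g' x = g x) :
    ∃ C > 0, ∃ r₁ > 0, ∃ k₁ : ℝ, ∀ k > k₁, ∀ (u : ℝ → ℝ) (U : ℝ) (x : ℝ → X × ℝ), 0 ≤ U →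
      IsSolution (highGainField g' k u) x → (∀ t, 0 ≤ t → |u t| ≤ U) → (x 0).1 ∈ Ω →
      Metric.infDist (x 0).1 A + |(x 0).2| + U ≤ r₁ →
      (∀ t, 0 ≤ t → ‖x t‖ ≤ RA) ∧
      (∀ t, 0 ≤ t → Metric.infDist (x t).1 A + |(x t).2| ≤
        C * (Metric.infDist (x 0).1 A + |(x 0).2| + U)) ∧
      (U = 0 → Tendsto (fun t => Metric.infDist (x t).1 A + |(x t).2|) atTop (𝓝 0)) := by
  have hball : ∀ (p : X) (e : ℝ), Metric.infDist p A ≤ 1 → |e| ≤ 1 → ‖(p, e)‖ ≤ RA :=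
    fun p e hp he => max_le (hRA p hp) (he.trans hRA1)
  have hA0' : ∀ a ∈ A, (g' (a, 0)).2 = 0 := fun a ha => by
    rw [hgg' _ ((hball a 0 (by simp [Metric.infDist_zero_of_mem ha]) (by simp)).trans hR)]
    exact hA0 a ha
  obtain ⟨C, hC, r₁, hr₁, k₁, h⟩ := exists_local_iss (Ω := Ω) hg' hL hA hne hA0' hr hT hM
    (fun p₀ hp₀ hd => by
      obtain ⟨p, hp, hp0, hpM, hpT⟩ := hnom p₀ hp₀ hd
      refine ⟨p, hp.congr fun t ht => ?_, hp0, hpM, hpT⟩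
      have h1 : Metric.infDist (p t) A ≤ 1 :=
        (hpM t ht).trans ((mul_le_mul_of_nonneg_left hd hM).trans hMr)
      rw [hgg' _ ((hball _ 0 h1 (by simp)).trans hR)])
  refine ⟨C, hC, r₁, hr₁, k₁, fun k hk u U x hU hx hu h0 hsmall => ?_⟩
  obtain ⟨h1, h2, h3⟩ := h k hk u U x hU hx hu (fun s hs hnear =>
    hΩ.mem_of_eq_on_ball hgg' hx h0 hs fun t ht =>
      (hball _ _ (hnear t ht).1 (hnear t ht).2).trans hR) hsmall
  refine ⟨fun t ht => ?_, h2, h3⟩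
  have h4 := h1 t ht
  have h5 : 0 ≤ Metric.infDist (x t).1 A := Metric.infDist_nonneg
  have h6 := abs_nonneg (x t).2
  exact hball (x t).1 (x t).2 (by linarith) (by linarith)

variable [ProperSpace X]

theorem exists_lipschitz_truncation {g : X × ℝ → X × ℝ} (hg : LocallyLipschitz g) (R : ℝ) :
    ∃ (g' : X × ℝ → X × ℝ) (L : NNReal) (B : ℝ), LipschitzWith L g' ∧ 1 ≤ L ∧ (∀ x, ‖g' x‖ ≤ B) ∧
      ∀ x, ‖x‖ ≤ R → g' x = g x := by
  obtain ⟨g', L, B, hL, hB, hgg', -⟩ := exists_lipschitz_bounded_eq_on_ball hg R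
  exact ⟨g', max L 1, B, hL.weaken (le_max_left _ _), le_max_right _ _, hB, hgg'⟩

/-- Total stability of `A × {0}` for large gain. -/
theorem exists_gain_totally_stable {g : X × ℝ → X × ℝ} (hg : LocallyLipschitz g) {A Ω : Set X}
    (hA : IsCompact A) (hne : A.Nonempty) (hA0 : ∀ a ∈ A, (g (a, 0)).2 = 0)
    (hΩ : HighGainInvariant g Ω) {r T M : ℝ} (hr : 0 < r) (hT : 0 < T) (hM : 0 ≤ M)
    (hMr : M * r ≤ 1) (hnom : NominalContraction g A Ω r T M) :
    ∃ k₁ : ℝ, ∀ k > k₁, ∀ ε > 0, ∃ δ₁ > 0, ∃ δ₂ > 0, ∀ p₀ ∈ Ω, Metric.infDist p₀ A ≤ δ₁ →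
      ∀ e₀ : ℝ, |e₀| ≤ δ₁ → ∀ u : ℝ → ℝ, ContinuousOn u (Ici 0) → (∀ t, 0 ≤ t → |u t| ≤ δ₂) →
      (∃ x, IsSolution (highGainField g k u) x ∧ x 0 = (p₀, e₀)) ∧
      ∀ x, IsSolution (highGainField g k u) x → x 0 = (p₀, e₀) →
        ∀ t, 0 ≤ t → Metric.infDist (x t).1 A ≤ ε ∧ |(x t).2| ≤ ε := by
  obtain ⟨RA, hRA1, hRA⟩ := exists_bound_of_infDist_le hA hne
  obtain ⟨g', L, B, hg', hL, -, hgg'⟩ := exists_lipschitz_truncation hg RA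
  obtain ⟨C, hC, r₁, hr₁, k₁, h⟩ := exists_local_iss_of_eq_on_ball hA hne hA0 hΩ hr hT hM hMr
    hnom hRA1 hRA le_rfl hg' hL hgg'
  refine ⟨k₁, fun k hk ε hε => ?_⟩
  set δ : ℝ := min (r₁ / 3) (ε / (3 * C)) with hδ
  have hδ0 : 0 < δ := by positivity
  have hδr : 3 * δ ≤ r₁ := by linarith [min_le_left (r₁ / 3) (ε / (3 * C))]
  have hδε : C * (3 * δ) ≤ ε := by
    have := min_le_right (r₁ / 3) (ε / (3 * C))
    rw [← hδ, le_div_iff₀ (by positivity)] at this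
    linarith
  refine ⟨δ, hδ0, δ, hδ0, fun p₀ hp₀ hpd e₀ he₀ u hu huδ => ?_⟩
  obtain ⟨x, hx, hx0⟩ := exists_isSolution_highGainField hg' k hu (p₀, e₀)
  obtain ⟨h1, h2, -⟩ := h k hk u δ x hδ0.le hx huδ (by rw [hx0]; exact hp₀)
    (by rw [hx0]; simp only; linarith)
  have hx' : IsSolution (highGainField g k u) x := hx.congr fun t ht => by
    simp only [highGainField, hgg' _ (h1 t ht)]
  refine ⟨⟨x, hx', hx0⟩, fun y hy hy0 t ht => ?_⟩
  rw [isSolution_highGainField_eqOn hg hy hx' (hy0.trans hx0.symm) ht]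
  have h3 := h2 t ht
  rw [hx0] at h3
  have h4 : C * (Metric.infDist p₀ A + |e₀| + δ) ≤ C * (3 * δ) := by
    gcongr; linarith
  have h5 : 0 ≤ Metric.infDist (x t).1 A := Metric.infDist_nonneg
  have h6 := abs_nonneg (x t).2
  simp only at h3
  exact ⟨by linarith, by linarith⟩

/-- For large gain all solutions starting near a point attracted by `A`, with error at most `c`,
exist, are bounded and converge to `A × {0}`. -/
theorem exists_gain_attracted_nhds {g : X × ℝ → X × ℝ} (hg : LocallyLipschitz g) {A Ω : Set X}
    (hA : IsCompact A) (hne : A.Nonempty) (hA0 : ∀ a ∈ A, (g (a, 0)).2 = 0)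
    (hΩ : HighGainInvariant g Ω) {r T M : ℝ} (hr : 0 < r) (hT : 0 < T) (hM : 0 ≤ M)
    (hMr : M * r ≤ 1) (hnom : NominalContraction g A Ω r T M) {c : ℝ} (hc : 0 ≤ c) {p : ℝ → X}
    (hp : IsSolution (fun _ p => (g (p, 0)).1) p)
    (hlim : Tendsto (fun t => Metric.infDist (p t) A) atTop (𝓝 0)) :
    ∃ V ∈ 𝓝 (p 0), ∃ k₁ R : ℝ, ∀ k > k₁, ∀ p₀ ∈ V ∩ Ω, ∀ e₀ : ℝ, |e₀| ≤ c →
      ∃ x, IsSolution (highGainField g k fun _ => 0) x ∧ x 0 = (p₀, e₀) ∧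
        (∀ t, 0 ≤ t → ‖x t‖ ≤ R) ∧
        Tendsto (fun t => Metric.infDist (x t).1 A + |(x t).2|) atTop (𝓝 0) := by
  obtain ⟨RA, hRA1, hRA⟩ := exists_bound_of_infDist_le hA hne
  obtain ⟨Rp, hRp⟩ := exists_norm_bound_of_tendsto_infDist hA hne hp.continuousOn hlim
  set R : ℝ := max RA (max (Rp + 1) (c + 1)) with hR
  have hR1 : RA ≤ R := le_max_left _ _
  have hR2 : Rp + 1 ≤ R := (le_max_left _ _).trans (le_max_right _ _)
  have hR3 : c + 1 ≤ R := (le_max_right _ _).trans (le_max_right _ _)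
  obtain ⟨g', L, B, hg', hL, hB, hgg'⟩ := exists_lipschitz_truncation hg R
  obtain ⟨C, hC, r₁, hr₁, k₁, hloc⟩ := exists_local_iss_of_eq_on_ball hA hne hA0 hΩ hr hT hM hMr
    hnom hRA1 hRA hR1 hg' hL hgg'
  -- `t₁` is a time at which the nominal solution from `p 0` is well inside the local domain
  obtain ⟨t₁, ht₁0, ht₁⟩ : ∃ t₁ > 0, Metric.infDist (p t₁) A ≤ r₁ / 3 :=
    ((eventually_gt_atTop 0).and (hlim.eventually_le_const (by positivity))).exists
  have hp' : IsSolution (fun _ p => (g' (p, 0)).1) p := hp.congr fun t ht => by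
    rw [hgg']
    refine max_le ((hRp t ht).trans (by linarith)) ?_
    simp only [norm_zero]; linarith
  obtain ⟨σ, hσ, k₂, htr⟩ := exists_transient_bound hg' hB hp' ht₁0 hc
    (η := min 1 (r₁ / 3)) (by positivity)
  refine ⟨Metric.closedBall (p 0) σ, Metric.closedBall_mem_nhds _ hσ, max k₁ k₂, R,
    fun k hk p₀ hp₀ e₀ he₀ => ?_⟩
  obtain ⟨x, hx, hx0⟩ := exists_isSolution_highGainField hg' k
    (continuousOn_const (c := (0 : ℝ))) (p₀, e₀)
  obtain ⟨hnear, hend⟩ := htr k ((le_max_right _ _).trans_lt hk) x hx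
    (by rw [hx0]; exact hp₀.1) (by rw [hx0]; exact he₀)
  have hxR : ∀ t ∈ Icc 0 t₁, ‖x t‖ ≤ R := fun t ht => by
    obtain ⟨h1, h2⟩ := hnear t ht
    have h3 : ‖(x t).1‖ ≤ ‖p t‖ + dist (x t).1 (p t) := by
      rw [dist_eq_norm]; exact norm_le_insert' _ _
    have h4 := hRp t ht.1
    have h5 := h1.trans (min_le_left _ _)
    exact max_le (by linarith) (h2.trans hR3)
  have hmem : (x t₁).1 ∈ Ω :=
    hΩ.mem_of_eq_on_ball hgg' hx (by rw [hx0]; exact hp₀.2) ht₁0.le hxR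
  have hx₁ : IsSolution (highGainField g' k fun _ => 0) fun t => x (t₁ + t) := hx.shift ht₁0.le
  have hd : Metric.infDist (x t₁).1 A ≤ Metric.infDist (p t₁) A + dist (x t₁).1 (p t₁) :=
    Metric.infDist_le_infDist_add_dist
  obtain ⟨h1, -, h3⟩ := hloc k ((le_max_left _ _).trans_lt hk) _ 0 _ le_rfl hx₁ (by simp)
    (by simpa using hmem) (by
      have h4 := (hnear t₁ ⟨ht₁0.le, le_rfl⟩).1.trans (min_le_right _ _)
      have h5 := hend.trans (min_le_right _ _)
      simp only [add_zero]
      linarith)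
  have hball : ∀ t, 0 ≤ t → ‖x t‖ ≤ R := fun t ht => by
    rcases le_total t t₁ with h | h
    · exact hxR t ⟨ht, h⟩
    · have := h1 (t - t₁) (by linarith)
      rw [add_sub_cancel] at this
      exact this.trans hR1
  refine ⟨x, hx.congr fun t ht => ?_, hx0, hball, ?_⟩
  · simp only [highGainField, hgg' _ (hball t ht)]
  · have h4 := (h3 rfl).comp (tendsto_atTop_add_const_right atTop (-t₁) tendsto_id)
    refine h4.congr fun t => ?_
    simp

/-- Semiglobal stabilization: for large gain all solutions
starting in a given compact set attracted by `A`, with error at most `c`, exist, are uniformly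
bounded and converge to `A × {0}`. -/
theorem exists_gain_attracted_compact {g : X × ℝ → X × ℝ} (hg : LocallyLipschitz g) {A Ω : Set X}
    (hA : IsCompact A) (hne : A.Nonempty) (hA0 : ∀ a ∈ A, (g (a, 0)).2 = 0)
    (hΩ : HighGainInvariant g Ω) {r T M : ℝ} (hr : 0 < r) (hT : 0 < T) (hM : 0 ≤ M)
    (hMr : M * r ≤ 1) (hnom : NominalContraction g A Ω r T M) {c : ℝ} (hc : 0 ≤ c) {K : Set X}
    (hK : IsCompact K) (hKatt : ∀ p₀ ∈ K, p₀ ∈ Ω ∧ ∃ p : ℝ → X,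
      IsSolution (fun _ p => (g (p, 0)).1) p ∧ p 0 = p₀ ∧
      Tendsto (fun t => Metric.infDist (p t) A) atTop (𝓝 0)) :
    ∃ k₁ R : ℝ, ∀ k > k₁, ∀ p₀ ∈ K, ∀ e₀ : ℝ, |e₀| ≤ c →
      ∃ x, IsSolution (highGainField g k fun _ => 0) x ∧ x 0 = (p₀, e₀) ∧
        (∀ t, 0 ≤ t → ‖x t‖ ≤ R) ∧
        Tendsto (fun t => Metric.infDist (x t).1 A + |(x t).2|) atTop (𝓝 0) := by
  suffices h : ∃ k₁ R : ℝ, ∀ k > k₁, ∀ p₀ ∈ K ∩ Ω, ∀ e₀ : ℝ, |e₀| ≤ c →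
      ∃ x, IsSolution (highGainField g k fun _ => 0) x ∧ x 0 = (p₀, e₀) ∧
        (∀ t, 0 ≤ t → ‖x t‖ ≤ R) ∧
        Tendsto (fun t => Metric.infDist (x t).1 A + |(x t).2|) atTop (𝓝 0) by
    obtain ⟨k₁, R, h⟩ := h
    exact ⟨k₁, R, fun k hk p₀ hp₀ => h k hk p₀ ⟨hp₀, (hKatt p₀ hp₀).1⟩⟩
  -- the gain and the bound are uniform near each point, hence on `K` by compactness
  refine hK.induction_on (p := fun K => ∃ k₁ R : ℝ, ∀ k > k₁, ∀ p₀ ∈ K ∩ Ω, ∀ e₀ : ℝ,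
      |e₀| ≤ c → ∃ x, IsSolution (highGainField g k fun _ => 0) x ∧ x 0 = (p₀, e₀) ∧
        (∀ t, 0 ≤ t → ‖x t‖ ≤ R) ∧
        Tendsto (fun t => Metric.infDist (x t).1 A + |(x t).2|) atTop (𝓝 0)) ?_ ?_ ?_ ?_
  · exact ⟨0, 0, fun k _ p₀ hp₀ => hp₀.1.elim⟩
  · rintro s t hst ⟨k₁, R, h⟩
    exact ⟨k₁, R, fun k hk p₀ hp₀ => h k hk p₀ ⟨hst hp₀.1, hp₀.2⟩⟩
  · rintro s t ⟨k₁, R, h⟩ ⟨k₂, R', h'⟩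
    refine ⟨max k₁ k₂, max R R', fun k hk p₀ hp₀ e₀ he₀ => ?_⟩
    rcases hp₀.1 with hs | ht
    · obtain ⟨x, hx, hx0, hxR, hlim⟩ := h k ((le_max_left _ _).trans_lt hk) p₀ ⟨hs, hp₀.2⟩ e₀ he₀
      exact ⟨x, hx, hx0, fun t ht => (hxR t ht).trans (le_max_left _ _), hlim⟩
    · obtain ⟨x, hx, hx0, hxR, hlim⟩ := h' k ((le_max_right _ _).trans_lt hk) p₀ ⟨ht, hp₀.2⟩ e₀ he₀
      exact ⟨x, hx, hx0, fun t ht => (hxR t ht).trans (le_max_right _ _), hlim⟩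
  · intro p₀ hp₀
    obtain ⟨-, p, hp, rfl, hlim⟩ := hKatt p₀ hp₀
    obtain ⟨V, hV, h⟩ := exists_gain_attracted_nhds hg hA hne hA0 hΩ hr hT hM hMr hnom hc hp hlim
    exact ⟨V, mem_nhdsWithin_of_mem_nhds hV, h⟩

end HighGainLocallyLipschitz

/-! ### Limit sets, and the cascade of a driving system and the observer -/

section Omega

variable {E : Type*} [NormedAddCommGroup E] [NormedSpace ℝ E]

theorem isClosed_omegaSet (v : E → E) (B : Set E) : IsClosed (omegaSet v B) :=
  isClosed_iInter fun _ => isClosed_closure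

theorem omegaSet_subset {v : E → E} {B K : Set E} (hK : IsClosed K)
    (h : ∀ x : ℝ → E, IsSolution (fun _ => v) x → x 0 ∈ B → ∀ t, 0 ≤ t → x t ∈ K) :
    omegaSet v B ⊆ K := by
  refine (iInter_subset _ 0).trans (closure_minimal ?_ hK)
  rintro y ⟨x, hx, hx0, t, ht, -, rfl⟩
  exact h x hx hx0 t ht

/-- A trajectory in a compact set comes arbitrarily close to some point of the `ω`-limit set. -/
theorem exists_mem_omegaSet {v : E → E} {B K : Set E} (hK : IsCompact K) {x : ℝ → E}
    (hx : IsSolution (fun _ => v) x) (hx0 : x 0 ∈ B) (hxK : ∀ t, 0 ≤ t → x t ∈ K) :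
    ∃ y ∈ omegaSet v B, ∀ ε > 0, ∃ t, 0 ≤ t ∧ dist (x t) y < ε := by
  obtain ⟨y, -, φ, hφ, hlim⟩ := hK.tendsto_subseq (x := fun n : ℕ => x n)
    fun n => hxK n n.cast_nonneg
  refine ⟨y, mem_iInter.2 fun T => ?_, fun ε hε => ?_⟩
  · refine mem_closure_of_tendsto hlim ?_
    filter_upwards [(tendsto_natCast_atTop_atTop.comp hφ.tendsto_atTop).eventually_ge_atTop T]
      with n hn
    exact ⟨x, hx, hx0, φ n, Nat.cast_nonneg _, hn, rfl⟩
  · obtain ⟨n, hn⟩ := (hlim.eventually (Metric.ball_mem_nhds y hε)).exists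
    exact ⟨φ n, Nat.cast_nonneg _, hn⟩

end Omega

section Cascade

variable {E : Type*} [NormedAddCommGroup E] [NormedSpace ℝ E] {d : ℕ}

theorem lipschitzOnWith_toLp {Y : Type*} [PseudoMetricSpace Y] {F : Fin d → Y → ℝ} {K : NNReal}
    {s : Set Y} (h : ∀ i, LipschitzOnWith K (F i) s) :
    ∃ K', LipschitzOnWith K' (fun x => (WithLp.toLp 2 fun i => F i x : Vec d)) s := by
  refine ⟨⟨√d, Real.sqrt_nonneg _⟩ * K, LipschitzOnWith.of_dist_le_mul fun x hx y hy => ?_⟩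
  rw [dist_eq_norm]
  refine (norm_le_sqrt_mul_of_forall_abs_le (m := K * dist x y) (by positivity) fun i => ?_).trans
    (mul_assoc _ _ _).ge
  have := (h i).dist_le_mul x hx y hy
  rwa [Real.dist_eq] at this

theorem locallyLipschitz_toLp {Y : Type*} [PseudoMetricSpace Y] {F : Fin d → Y → ℝ}
    (h : ∀ i, LocallyLipschitz (F i)) :
    LocallyLipschitz (fun x => (WithLp.toLp 2 fun i => F i x : Vec d)) := by
  intro x
  choose K t ht hK using fun i => h i x
  obtain ⟨K', hK'⟩ := lipschitzOnWith_toLp (F := F) (K := ∑ i, K i) (s := ⋂ i, t i) fun i =>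
    ((hK i).mono (iInter_subset _ i)).weaken
      (Finset.single_le_sum (f := K) (fun _ _ => zero_le) (Finset.mem_univ i))
  exact ⟨K', _, iInter_mem.2 ht, hK'⟩

theorem lipschitzWith_proj (i : Fin d) : LipschitzWith 1 fun x : Vec d => x i :=
  LipschitzWith.of_dist_le_mul fun x y => by
    rw [NNReal.coe_one, one_mul, dist_eq_norm, dist_eq_norm]
    exact PiLp.norm_apply_le (x - y) i

theorem exists_lipschitzWith_PhiC {φ : Vec d → ℝ} {L : NNReal} (hφ : LipschitzWith L φ) :
    ∃ L', LipschitzWith L' (PhiC φ) := by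
  obtain ⟨K', hK'⟩ := lipschitzOnWith_toLp (K := 1 + L) (s := univ)
    (F := fun i (ξ : Vec d) => if h : (i : ℕ) + 1 < d then ξ ⟨(i : ℕ) + 1, h⟩ else -φ ξ) (by
      intro i
      rw [lipschitzOnWith_univ]
      by_cases h : (i : ℕ) + 1 < d
      · simp only [h, dif_pos]
        exact (lipschitzWith_proj _).weaken (le_add_of_nonneg_right zero_le)
      · simp only [h, dif_neg, not_false_eq_true]
        exact hφ.neg.weaken (le_add_of_nonneg_left zero_le))
  exact ⟨K', lipschitzOnWith_univ.1 hK'⟩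

variable [NeZero d]

/-- The cascade of `ż = v(z)` and the observer driven by the measurement `τ(z)₁`. -/
noncomputable def cascadeField (v : E → E) (τ : E → Vec d) (φ : Vec d → ℝ) (G : Vec d)
    (p : E × Vec d) : E × Vec d :=
  (v p.1, PhiC φ p.2 + (τ p.1 0 - p.2 0) • G)

theorem exists_isSolution_cascadeField {v : E → E} {τ : E → Vec d} (hτ : Continuous τ)
    {φ : Vec d → ℝ} {L : NNReal} (hφ : LipschitzWith L φ) (G : Vec d) {z : ℝ → E}
    (hz : IsSolution (fun _ => v) z) (ξ₀ : Vec d) :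
    ∃ ξ : ℝ → Vec d, ξ 0 = ξ₀ ∧ IsSolution (fun _ => cascadeField v τ φ G) fun t => (z t, ξ t) := by
  obtain ⟨L', hL'⟩ := exists_lipschitzWith_PhiC hφ
  have hy : Continuous fun t => τ (z (max t 0)) 0 :=
    (lipschitzWith_proj 0).continuous.comp (hτ.comp hz.continuous_max)
  have hsm : LipschitzWith ‖G‖₊ fun a : ℝ => a • G :=
    LipschitzWith.of_dist_le_mul fun a b => by
      rw [dist_eq_norm, ← sub_smul, norm_smul, dist_eq_norm, mul_comm]; rfl
  obtain ⟨ξ, hξ, hξ0⟩ := exists_isSolution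
    (v := fun t (ξ : Vec d) => PhiC φ ξ + (τ (z (max t 0)) 0 - ξ 0) • G)
    (K := L' + ‖G‖₊ * (0 + 1))
    (fun t => hL'.add (hsm.comp ((LipschitzWith.const _).sub (lipschitzWith_proj 0))))
    (fun ξ => continuous_const.add ((hy.sub continuous_const).smul continuous_const)) ξ₀
  refine ⟨ξ, hξ0, fun t ht => ?_⟩
  have h1 := hξ t ht
  simp only [max_eq_left ht] at h1
  exact (hz t ht).prodMk h1

/-- The gauge `|ξ - τ(z)| + R |z|_{A₀}` of `p = (z, ξ)`, which is comparable with the distance of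
`p` from the graph of `τ` over `A₀`. -/
noncomputable def cascadeGauge (τ : E → Vec d) (A₀ : Set E) (R : ℝ) (p : E × Vec d) : ℝ :=
  ‖p.2 - τ p.1‖ + R * Metric.infDist p.1 A₀

/-- The assumptions on the driving system `ż = v(z)` of the cascade: its solutions starting in `B`
at distance at most `r` from the compact set `A₀` stay in `B ∩ K` and approach `A₀` exponentially,
and `A₀` is filled with solutions along which `τ` solves `σ̇ = Φ(σ)`. -/
structure DrivingSystem (v : E → E) (τ : E → Vec d) (φ : Vec d → ℝ) (A₀ B K : Set E)
    (m a r : ℝ) : Prop where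
  isCompact : IsCompact A₀
  nonempty : A₀.Nonempty
  subset : A₀ ⊆ K
  exists_lipschitzOnWith : ∃ L, LipschitzOnWith L v K
  exists_lipschitzOnWith_tau : ∃ L, LipschitzOnWith L τ K
  exists_solution : ∀ a₀ ∈ A₀, ∃ α : ℝ → E, IsSolution (fun _ => v) α ∧ α 0 = a₀ ∧
    (∀ t, 0 ≤ t → α t ∈ A₀) ∧ IsSolution (fun _ => PhiC φ) fun t => τ (α t)
  mem : ∀ z : ℝ → E, IsSolution (fun _ => v) z → z 0 ∈ B → Metric.infDist (z 0) A₀ ≤ r →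
    ∀ t, 0 ≤ t → z t ∈ B ∧ z t ∈ K
  exp_le : ∀ z : ℝ → E, IsSolution (fun _ => v) z → z 0 ∈ B → Metric.infDist (z 0) A₀ ≤ r →
    ∀ t, 0 ≤ t → Metric.infDist (z t) A₀ ≤ m * Real.exp (-a * t) * Metric.infDist (z 0) A₀

/-- Over a suitable time `T` the gauge of the cascade is halved. The observer state is compared with
`τ(α(t))`, where `α` is the solution in `A₀` starting at the point nearest to `z(0)`, because `τ`
solves the observer's model exactly only along solutions in `A₀`, while `z - α` is bounded linearly
in `|z(0)|_{A₀}`. -/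
theorem DrivingSystem.exists_window {v : E → E} {τ : E → Vec d} {φ : Vec d → ℝ} {A₀ B K : Set E}
    {m a r : ℝ} (h : DrivingSystem v τ φ A₀ B K m a r) (hm : 1 ≤ m) (ha : 0 < a) {G : Vec d}
    {C β : ℝ} (hC : 0 ≤ C) (hβ : 0 < β) (hobs : ObserverErrorBound φ G C β) :
    ∃ T > 0, ∃ R ≥ 1, ∃ M ≥ 1, ∀ p : ℝ → E × Vec d, IsSolution (fun _ => cascadeField v τ φ G) p →
      (p 0).1 ∈ B → Metric.infDist (p 0).1 A₀ ≤ r →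
      Metric.infDist (p T).1 A₀ ≤ Metric.infDist (p 0).1 A₀ ∧
      cascadeGauge τ A₀ R (p T) ≤ 1 / 2 * cascadeGauge τ A₀ R (p 0) ∧
      ∀ t ∈ Icc 0 T, cascadeGauge τ A₀ R (p t) ≤ M * cascadeGauge τ A₀ R (p 0) := by
  obtain ⟨Lv, hLv⟩ := h.exists_lipschitzOnWith
  obtain ⟨Lτ, hLτ⟩ := h.exists_lipschitzOnWith_tau
  have hexp : ∀ (A b : ℝ), 0 < b → ∀ᶠ t in atTop, A * Real.exp (-b * t) ≤ 1 / 4 := by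
    intro A b hb
    have h1 : Tendsto (fun t : ℝ => A * Real.exp (-b * t)) atTop (𝓝 (A * 0)) :=
      (Real.tendsto_exp_atBot.comp (tendsto_id.const_mul_atTop_of_neg (by linarith))).const_mul A
    rw [mul_zero] at h1
    exact h1.eventually_le_const (by norm_num)
  obtain ⟨T, hT, hTC, hTm⟩ : ∃ T > 0, C * Real.exp (-β * T) ≤ 1 / 4 ∧
      m * Real.exp (-a * T) ≤ 1 / 4 :=
    ((eventually_gt_atTop 0).and ((hexp C β hβ).and (hexp m a ha))).exists
  set c : ℝ := Real.exp (Lv * T) with hc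
  -- `C₂ |z(0)|_{A₀}` bounds what the driving system adds to the observer error; the weight
  -- `R = 4 C₂ + 1` makes this at most a quarter of the gauge
  set C₂ : ℝ := C * Lτ + C * (Lτ * c) + Lτ * c with hC₂
  have hC₂0 : 0 ≤ C₂ := by positivity
  refine ⟨T, hT, 4 * C₂ + 1, by linarith, C + 1 + m, by linarith, fun p hp hpB hpr => ?_⟩
  have hz : IsSolution (fun _ => v) fun t => (p t).1 := fun t ht => (hp t ht).prod_fst
  have hξ : ∀ t, 0 ≤ t → HasDerivWithinAt (fun t => (p t).2)
      (PhiC φ (p t).2 + (τ (p t).1 0 - (p t).2 0) • G) (Ici 0) t := fun t ht => (hp t ht).prod_snd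
  set D₀ := Metric.infDist (p 0).1 A₀ with hD₀
  have hD₀0 : 0 ≤ D₀ := Metric.infDist_nonneg
  set X₀ := ‖(p 0).2 - τ (p 0).1‖ with hX₀
  have hX₀0 : 0 ≤ X₀ := norm_nonneg _
  obtain ⟨a₀, ha₀, hza⟩ := h.isCompact.exists_infDist_eq_dist h.nonempty (p 0).1
  obtain ⟨α, hα, hα0, hαA, hσ⟩ := h.exists_solution a₀ ha₀
  have hzK : ∀ t, 0 ≤ t → (p t).1 ∈ K := fun t ht => (h.mem _ hz hpB hpr t ht).2
  have hαK : ∀ t, 0 ≤ t → α t ∈ K := fun t ht => h.subset (hαA t ht)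
  have hdist : ∀ t ∈ Icc 0 T, dist (p t).1 (α t) ≤ c * D₀ := by
    intro t ht
    have h1 := dist_le_of_trajectories_ODE_of_mem (v := fun _ => v) (s := fun _ => K) (a := 0)
      (b := T) (δ := D₀) (fun _ _ => hLv) (hz.continuousOn.mono Icc_subset_Ici_self)
      (fun s hs => hz.hasDerivWithinAt_Ici hs.1) (fun s hs => hzK s hs.1)
      (hα.continuousOn.mono Icc_subset_Ici_self)
      (fun s hs => hα.hasDerivWithinAt_Ici hs.1) (fun s hs => hαK s hs.1)
      (by rw [hα0]; exact hza.ge) t ht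
    rw [mul_comm, sub_zero] at h1
    refine h1.trans ?_
    rw [hc]
    gcongr
    exact ht.2
  have hτd : ∀ t ∈ Icc 0 T, ‖τ (p t).1 - τ (α t)‖ ≤ Lτ * (c * D₀) := by
    intro t ht
    rw [← dist_eq_norm]
    exact (hLτ.dist_le_mul _ (hzK t ht.1) _ (hαK t ht.1)).trans (by gcongr; exact hdist t ht)
  have hX0α : ‖(p 0).2 - τ (α 0)‖ ≤ X₀ + Lτ * D₀ := by
    have h1 : ‖τ (p 0).1 - τ (α 0)‖ ≤ Lτ * D₀ := by
      rw [← dist_eq_norm, hD₀, hza, ← hα0]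
      exact hLτ.dist_le_mul _ (hzK 0 le_rfl) _ (hαK 0 le_rfl)
    have h2 := norm_sub_le_norm_sub_add_norm_sub (p 0).2 (τ (p 0).1) (τ (α 0))
    linarith
  have hX : ∀ t ∈ Icc 0 T,
      ‖(p t).2 - τ (p t).1‖ ≤ C * Real.exp (-β * t) * X₀ + C₂ * D₀ := by
    intro t ht
    have h1 := hobs (fun t => (p t).2) (fun t => τ (α t)) (fun t => τ (p t).1 0) (Lτ * (c * D₀)) T
      (by positivity) (continuous_snd.comp_continuousOn
        (hp.continuousOn.mono Icc_subset_Ici_self))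
      (hσ.continuousOn.mono Icc_subset_Ici_self)
      (fun s hs => (hξ s hs.1).mono (Ici_subset_Ici.2 hs.1))
      (fun s hs => hσ.hasDerivWithinAt_Ici hs.1)
      (fun s hs => (PiLp.norm_apply_le (τ (p s).1 - τ (α s)) 0).trans
        (hτd s (Ico_subset_Icc_self hs))) t ht
    have h2 := norm_sub_le_norm_sub_add_norm_sub (p t).2 (τ (α t)) (τ (p t).1)
    rw [norm_sub_rev (τ (α t))] at h2
    have h3 := hτd t ht
    have h4 : C * (Real.exp (-β * t) * ‖(p 0).2 - τ (α 0)‖ + Lτ * (c * D₀)) ≤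
        C * (Real.exp (-β * t) * (X₀ + Lτ * D₀) + Lτ * (c * D₀)) := by gcongr
    have h5 : C * (Real.exp (-β * t) * (Lτ * D₀)) ≤ C * (1 * (Lτ * D₀)) := by
      gcongr
      exact Real.exp_le_one_iff.2 (by nlinarith [ht.1])
    rw [hC₂]
    linarith
  have hD := h.exp_le _ hz hpB hpr
  simp only [← hD₀] at hD
  unfold cascadeGauge
  refine ⟨?_, ?_, ?_⟩
  · have h4 : m * Real.exp (-a * T) * D₀ ≤ 1 / 4 * D₀ := by gcongr
    linarith [hD T hT.le]
  · have h1 := hX T ⟨hT.le, le_rfl⟩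
    have h2 := hD T hT.le
    have h3 : C * Real.exp (-β * T) * X₀ ≤ 1 / 4 * X₀ := by gcongr
    have h4 : m * Real.exp (-a * T) * D₀ ≤ 1 / 4 * D₀ := by gcongr
    have h5 := mul_le_mul_of_nonneg_left (h2.trans h4) (by linarith : 0 ≤ 4 * C₂ + 1)
    linarith
  · intro t ht
    have h1 := hX t ht
    have h2 := hD t ht.1
    have h3 : C * Real.exp (-β * t) * X₀ ≤ C * 1 * X₀ := by
      gcongr
      exact Real.exp_le_one_iff.2 (by nlinarith [ht.1])
    have h4 : m * Real.exp (-a * t) * D₀ ≤ m * 1 * D₀ := by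
      gcongr
      exact Real.exp_le_one_iff.2 (by nlinarith [ht.1])
    have h5 := mul_le_mul_of_nonneg_left (h2.trans h4) (by linarith : 0 ≤ 4 * C₂ + 1)
    have h6 : 0 ≤ (1 + m) * X₀ := by positivity
    have h7 : 0 ≤ (C + 1) * ((4 * C₂ + 1) * D₀) := by positivity
    have h8 : 0 ≤ (3 * C₂ + 1) * D₀ := by positivity
    have h9 : 0 ≤ C * ((4 * C₂ + 1) * D₀) := by positivity
    linarith

/-- Exponential decay of the gauge: the window estimate iterated. -/
theorem DrivingSystem.exists_gauge_decay {v : E → E} {τ : E → Vec d} {φ : Vec d → ℝ}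
    {A₀ B K : Set E} {m a r : ℝ} (h : DrivingSystem v τ φ A₀ B K m a r) (hm : 1 ≤ m) (ha : 0 < a)
    {G : Vec d} {C β : ℝ} (hC : 0 ≤ C) (hβ : 0 < β) (hobs : ObserverErrorBound φ G C β) :
    ∃ T > 0, ∃ R ≥ 1, ∃ M ≥ 1, ∀ p : ℝ → E × Vec d, IsSolution (fun _ => cascadeField v τ φ G) p →
      (p 0).1 ∈ B → Metric.infDist (p 0).1 A₀ ≤ r →
      (∀ j : ℕ, cascadeGauge τ A₀ R (p (j * T)) ≤ (1 / 2) ^ j * cascadeGauge τ A₀ R (p 0)) ∧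
      ∀ t, 0 ≤ t → cascadeGauge τ A₀ R (p t) ≤
        M * ((1 / 2) ^ ⌊t / T⌋₊ * cascadeGauge τ A₀ R (p 0)) := by
  obtain ⟨T, hT, R, hR, M, hM, hwin⟩ := h.exists_window hm ha hC hβ hobs
  refine ⟨T, hT, R, hR, M, hM, fun p hp hpB hpr => ?_⟩
  have hz : IsSolution (fun _ => v) fun t => (p t).1 := fun t ht => (hp t ht).prod_fst
  have hshift : ∀ j : ℕ, IsSolution (fun _ => cascadeField v τ φ G) fun t => p (j * T + t) :=
    fun j => hp.shift (by positivity)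
  have hB : ∀ j : ℕ, (p (j * T)).1 ∈ B := fun j => (h.mem _ hz hpB hpr _ (by positivity)).1
  have hstep : ∀ j : ℕ, Metric.infDist (p (j * T)).1 A₀ ≤ r →
      Metric.infDist (p (j * T + T)).1 A₀ ≤ Metric.infDist (p (j * T)).1 A₀ ∧
      cascadeGauge τ A₀ R (p (j * T + T)) ≤ 1 / 2 * cascadeGauge τ A₀ R (p (j * T)) ∧
      ∀ t ∈ Icc 0 T, cascadeGauge τ A₀ R (p (j * T + t)) ≤ M * cascadeGauge τ A₀ R (p (j * T)) := by
    intro j hj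
    have := hwin _ (hshift j) (by simpa using hB j) (by simpa using hj)
    simpa only [add_zero] using this
  have hind : ∀ j : ℕ, Metric.infDist (p (j * T)).1 A₀ ≤ r ∧
      cascadeGauge τ A₀ R (p (j * T)) ≤ (1 / 2) ^ j * cascadeGauge τ A₀ R (p 0) := by
    intro j
    induction j with
    | zero => simpa using hpr
    | succ j ih =>
      obtain ⟨h1, h2, -⟩ := hstep j ih.1
      have e1 : ((j + 1 : ℕ) : ℝ) * T = j * T + T := by push_cast; ring
      rw [e1, pow_succ]
      exact ⟨h1.trans ih.1, by linarith [ih.2]⟩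
  refine ⟨fun j => (hind j).2, fun t ht => ?_⟩
  have h1 : ⌊t / T⌋₊ * T ≤ t := by
    rw [← le_div_iff₀ hT]; exact Nat.floor_le (by positivity)
  have h2 : t < ⌊t / T⌋₊ * T + T := by
    have := Nat.lt_floor_add_one (t / T)
    rw [div_lt_iff₀ hT] at this
    linarith
  have h3 := (hstep ⌊t / T⌋₊ (hind _).1).2.2 (t - ⌊t / T⌋₊ * T) ⟨by linarith, by linarith⟩
  rw [add_sub_cancel] at h3
  refine h3.trans ?_
  gcongr
  exact (hind _).2

/-- The graph of `τ` over `A₀` is exponentially attractive for the cascade. -/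
theorem DrivingSystem.exists_graph_contraction {v : E → E} {τ : E → Vec d} {φ : Vec d → ℝ}
    {A₀ B K : Set E} {m a r : ℝ} (h : DrivingSystem v τ φ A₀ B K m a r) (hm : 1 ≤ m) (ha : 0 < a)
    {G : Vec d} {C β : ℝ} (hC : 0 ≤ C) (hβ : 0 < β) (hobs : ObserverErrorBound φ G C β)
    {A : Set (E × Vec d)} (hA : A = {p | p.1 ∈ A₀ ∧ p.2 = τ p.1}) (hAc : IsCompact A) :
    ∃ T > 0, ∃ M ≥ 0, ∀ p : ℝ → E × Vec d, IsSolution (fun _ => cascadeField v τ φ G) p →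
      (p 0).1 ∈ B → Metric.infDist (p 0).1 A₀ ≤ r →
      (∀ t, 0 ≤ t → Metric.infDist (p t) A ≤ M * Metric.infDist (p 0) A) ∧
      Metric.infDist (p T) A ≤ 1 / 2 * Metric.infDist (p 0) A ∧
      Tendsto (fun t => Metric.infDist (p t) A) atTop (𝓝 0) := by
  obtain ⟨T, hT, R, hR, M, hM, hdec⟩ := h.exists_gauge_decay hm ha hC hβ hobs
  obtain ⟨Lτ, hLτ⟩ := h.exists_lipschitzOnWith_tau
  have hne : A.Nonempty := by
    obtain ⟨z, hz⟩ := h.nonempty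
    exact ⟨(z, τ z), by rw [hA]; exact ⟨hz, rfl⟩⟩
  -- on `K` the gauge is equivalent to the distance to the graph
  have hle : ∀ p : E × Vec d, p.1 ∈ K → Metric.infDist p A ≤ (1 + Lτ) * cascadeGauge τ A₀ R p := by
    intro p hp
    obtain ⟨a₀, ha₀, hpa⟩ := h.isCompact.exists_infDist_eq_dist h.nonempty p.1
    have h1 : Metric.infDist p A ≤ dist p (a₀, τ a₀) :=
      Metric.infDist_le_dist_of_mem (by rw [hA]; exact ⟨ha₀, rfl⟩)
    have h2 := hLτ.dist_le_mul _ hp _ (h.subset ha₀)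
    have h3 := dist_triangle p.2 (τ p.1) (τ a₀)
    have h4 : 0 ≤ Metric.infDist p.1 A₀ := Metric.infDist_nonneg
    have h5 : 0 ≤ dist p.2 (τ p.1) := dist_nonneg
    have h6 : dist p (a₀, τ a₀) ≤ (1 + Lτ) * (dist p.2 (τ p.1) + Metric.infDist p.1 A₀) := by
      rw [Prod.dist_eq]
      rw [hpa] at h4 ⊢
      have h7 : 0 ≤ Lτ * dist p.2 (τ p.1) := by positivity
      have h8 : 0 ≤ Lτ * dist p.1 a₀ := by positivity
      exact max_le (by linarith) (by linarith)
    refine h1.trans (h6.trans ?_)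
    unfold cascadeGauge
    rw [dist_eq_norm]
    gcongr
    exact le_mul_of_one_le_left h4 hR
  have hge : ∀ p : E × Vec d, p.1 ∈ K →
      cascadeGauge τ A₀ R p ≤ (1 + Lτ + R) * Metric.infDist p A := by
    intro p hp
    obtain ⟨q, hq, hpq⟩ := hAc.exists_infDist_eq_dist hne p
    rw [hA] at hq
    have h1 : Metric.infDist p.1 A₀ ≤ dist p.1 q.1 := Metric.infDist_le_dist_of_mem hq.1
    have h2 : dist p.1 q.1 ≤ dist p q := le_max_left _ _
    have h3 : dist p.2 q.2 ≤ dist p q := le_max_right _ _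
    have h4 := hLτ.dist_le_mul _ hp _ (h.subset hq.1)
    have h5 := dist_triangle p.2 q.2 (τ p.1)
    have h6 : dist q.2 (τ p.1) ≤ Lτ * dist p q := by
      rw [hq.2, dist_comm]
      exact h4.trans (by gcongr)
    unfold cascadeGauge
    rw [hpq, ← dist_eq_norm]
    have h7 : R * Metric.infDist p.1 A₀ ≤ R * dist p q := by
      gcongr
      exact h1.trans h2
    linarith
  set M' : ℝ := (1 + Lτ) * (M * (1 + Lτ + R)) with hM'
  have hM'0 : 0 ≤ M' := by positivity
  -- `N` windows compensate the constants in the comparison of the gauge with the distance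
  obtain ⟨N, hN⟩ : ∃ N : ℕ, (1 / 2 : ℝ) ^ N ≤ 1 / 2 / (M' + 1) :=
    (exists_pow_lt_of_lt_one (by positivity) (by norm_num)).imp fun _ => le_of_lt
  have hN0 : 0 < N := by
    rcases Nat.eq_zero_or_pos N with h0 | h0
    · rw [h0, pow_zero, le_div_iff₀ (by positivity)] at hN
      linarith
    · exact h0
  refine ⟨N * T, by positivity, M', hM'0, fun p hp hpB hpr => ?_⟩
  have hz : IsSolution (fun _ => v) fun t => (p t).1 := fun t ht => (hp t ht).prod_fst
  have hK : ∀ t, 0 ≤ t → (p t).1 ∈ K := fun t ht => (h.mem _ hz hpB hpr t ht).2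
  obtain ⟨hd1, hd2⟩ := hdec p hp hpB hpr
  have hδ0 : 0 ≤ Metric.infDist (p 0) A := Metric.infDist_nonneg
  have hp0 := hge _ (hK 0 le_rfl)
  have hg0 : 0 ≤ cascadeGauge τ A₀ R (p 0) :=
    add_nonneg (norm_nonneg _) (mul_nonneg (by linarith) Metric.infDist_nonneg)
  have hall : ∀ t, 0 ≤ t → Metric.infDist (p t) A ≤
      M' * ((1 / 2) ^ ⌊t / T⌋₊ * Metric.infDist (p 0) A) := by
    intro t ht
    calc Metric.infDist (p t) A ≤ (1 + Lτ) * cascadeGauge τ A₀ R (p t) := hle _ (hK t ht)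
      _ ≤ (1 + Lτ) * (M * ((1 / 2) ^ ⌊t / T⌋₊ * ((1 + Lτ + R) * Metric.infDist (p 0) A))) := by
        gcongr
        exact (hd2 t ht).trans (by gcongr)
      _ = _ := by rw [hM']; ring
  refine ⟨fun t ht => (hall t ht).trans ?_, ?_, ?_⟩
  · gcongr
    exact mul_le_of_le_one_left hδ0 (pow_le_one₀ (by norm_num) (by norm_num))
  · calc Metric.infDist (p (N * T)) A ≤ (1 + Lτ) * cascadeGauge τ A₀ R (p (N * T)) :=
          hle _ (hK _ (by positivity))
      _ ≤ (1 + Lτ) * ((1 / 2 / (M' + 1)) * ((1 + Lτ + R) * Metric.infDist (p 0) A)) := by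
        gcongr
        exact (hd1 N).trans (mul_le_mul hN hp0 hg0 (by positivity))
      _ = ((1 + Lτ) * (1 * (1 + Lτ + R))) / (M' + 1) * (1 / 2 * Metric.infDist (p 0) A) := by
        field_simp
      _ ≤ 1 * (1 / 2 * Metric.infDist (p 0) A) := by
        gcongr
        rw [div_le_one (by positivity)]
        have : (1 + (Lτ : ℝ)) * (1 * (1 + Lτ + R)) ≤ M' := by
          rw [hM']; gcongr
        linarith
      _ = _ := one_mul _
  · have h1 : Tendsto (fun t : ℝ => ⌊t / T⌋₊) atTop atTop :=
      tendsto_nat_floor_atTop.comp (tendsto_id.atTop_div_const hT)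
    have h2 := (tendsto_pow_atTop_nhds_zero_of_lt_one (by norm_num : (0 : ℝ) ≤ 1 / 2)
      (by norm_num)).comp h1
    have h3 := (h2.mul_const (Metric.infDist (p 0) A)).const_mul M'
    rw [zero_mul, mul_zero] at h3
    refine squeeze_zero' (Eventually.of_forall fun t => Metric.infDist_nonneg) ?_ h3
    filter_upwards [eventually_ge_atTop 0] with t ht using hall t ht

end Cascade

/-! ### The closed loop -/

namespace Plant

variable {ν r n d : ℕ}

section Regularity

variable {S : Plant ν r n}

theorem locallyLipschitz_f0 (hs : LocallyLipschitz S.s) (hyr : ContDiff ℝ 1 S.yr)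
    (hf : ContDiff ℝ 1 S.f) : LocallyLipschitz S.f0 := by
  have h1 : ContDiff ℝ 1 fun z : ZSpace ν r n => S.f (z.2.2, S.yr z.2.1, z.1) := by fun_prop
  have h2 : LocallyLipschitz fun z : ZSpace ν r n => z.2.1 :=
    (LipschitzWith.prod_fst.comp LipschitzWith.prod_snd).locallyLipschitz
  exact (LocallyLipschitz.const 0).prodMk ((hs.comp h2).prodMk h1.locallyLipschitz)

/-- The formula for `L_s y_r` does not give this, since `y_r` is only `C¹`; it follows from the
smoothness of `q0 = τ₁`, of which `L_s y_r` is a summand. -/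
theorem locallyLipschitz_Lsyr (hyr : ContDiff ℝ 1 S.yr) (hq : ContDiff ℝ 1 S.q)
    (hq0 : ContDiff ℝ 1 S.q0) : LocallyLipschitz S.Lsyr := by
  have h1 : ContDiff ℝ 1 fun w : Vec r => S.q0 (0, w, 0) + S.q (0, S.yr w, 0) := by fun_prop
  have h2 : S.Lsyr = fun w : Vec r => S.q0 (0, w, 0) + S.q (0, S.yr w, 0) := by
    funext w
    simp [q0]
  rw [h2]
  exact h1.locallyLipschitz

theorem locallyLipschitz_tau (hτ : ∀ i < d, ContDiff ℝ 1 (S.tauSeq i)) :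
    LocallyLipschitz (S.tau d) :=
  locallyLipschitz_toLp fun i => (hτ i i.2).locallyLipschitz

variable [NeZero d]

/-- The right-hand side of the closed loop without the terms `-k e` and `u`. -/
noncomputable def openField (S : Plant ν r n) (φc : Vec d → ℝ) (G : Vec d)
    (x : PSpace ν r n d × ℝ) : PSpace ν r n d × ℝ :=
  (S.pField φc G x.1 x.2, S.eField G x.1 x.2)

theorem closedLoop_eq_highGainField (φc : Vec d → ℝ) (G : Vec d) (k : ℝ) (u : ℝ → ℝ) :
    S.closedLoop φc G k u = highGainField (S.openField φc G) k u := by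
  funext t x
  simp only [closedLoop, highGainField, openField, F0_add_F1, H0_add_H1]

/-- With regulated error zero the closed loop is the cascade of the plant and the observer. -/
theorem pField_zero (φc : Vec d → ℝ) (G : Vec d) (p : PSpace ν r n d) :
    S.pField φc G p 0 = cascadeField S.f0 (S.tau d) φc G p := by
  rw [← F0_add_F1, zero_smul, add_zero]
  rfl

theorem locallyLipschitz_openField (hs : LocallyLipschitz S.s) (hyr : ContDiff ℝ 1 S.yr)
    (hf : ContDiff ℝ 1 S.f) (hq : ContDiff ℝ 1 S.q) (hq0 : ContDiff ℝ 1 S.q0) {φc : Vec d → ℝ}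
    {L : NNReal} (hφc : LipschitzWith L φc) (G : Vec d) :
    LocallyLipschitz (S.openField φc G) := by
  have hw : LocallyLipschitz fun x : PSpace ν r n d × ℝ => x.1.1.2.1 :=
    (show ContDiff ℝ 1 fun x : PSpace ν r n d × ℝ => x.1.1.2.1 by fun_prop).locallyLipschitz
  have hξ : LocallyLipschitz fun x : PSpace ν r n d × ℝ => x.1.2 + x.2 • G :=
    (show ContDiff ℝ 1 fun x : PSpace ν r n d × ℝ => x.1.2 + x.2 • G by fun_prop).locallyLipschitz
  have hfz : LocallyLipschitz fun x : PSpace ν r n d × ℝ =>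
      S.f (x.1.1.2.2, x.2 + S.yr x.1.1.2.1, x.1.1.1) :=
    (show ContDiff ℝ 1 fun x : PSpace ν r n d × ℝ =>
      S.f (x.1.1.2.2, x.2 + S.yr x.1.1.2.1, x.1.1.1) by fun_prop).locallyLipschitz
  have hqz : LocallyLipschitz fun x : PSpace ν r n d × ℝ =>
      S.q (x.1.1.2.2, x.2 + S.yr x.1.1.2.1, x.1.1.1) :=
    (show ContDiff ℝ 1 fun x : PSpace ν r n d × ℝ =>
      S.q (x.1.1.2.2, x.2 + S.yr x.1.1.2.1, x.1.1.1) by fun_prop).locallyLipschitz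
  obtain ⟨L', hL'⟩ := exists_lipschitzWith_PhiC hφc
  have he : LocallyLipschitz fun x : PSpace ν r n d × ℝ => S.eField G x.1 x.2 :=
    (hqz.sub ((locallyLipschitz_Lsyr hyr hq hq0).comp hw)).add
      ((lipschitzWith_proj 0).locallyLipschitz.comp hξ)
  have heG : LocallyLipschitz fun x : PSpace ν r n d × ℝ => S.eField G x.1 x.2 • G :=
    (ContinuousLinearMap.toSpanSingleton ℝ G).lipschitz.locallyLipschitz.comp he
  have h1 := (LocallyLipschitz.const (α := PSpace ν r n d × ℝ) (0 : Vec ν)).prodMk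
    ((hs.comp hw).prodMk hfz)
  exact (h1.prodMk ((hL'.locallyLipschitz.comp hξ).sub heG)).prodMk he

/-- `μ` is constant and `w` is autonomous, so `P × W × ℝⁿ × ℝᵈ` is invariant whatever `e` does. -/
theorem highGainInvariant_openField (hs : LocallyLipschitz S.s) {P : Set (Vec ν)} {W : Set (Vec r)}
    (hW : ForwardInvariant S.s W) (φc : Vec d → ℝ) (G : Vec d) :
    HighGainInvariant (S.openField φc G) {p | p.1 ∈ P ×ˢ W ×ˢ (univ : Set (Vec n))} := by
  rintro k u x s hs0 hx hx' ⟨hμ, hw, -⟩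
  have hcz : ContinuousOn (fun t => (x t).1.1) (Icc 0 s) :=
    (continuous_fst.comp continuous_fst).comp_continuousOn hx
  have hz : ∀ t ∈ Ico 0 s, HasDerivWithinAt (fun t => (x t).1.1)
      (0, S.s (x t).1.1.2.1, S.f ((x t).1.1.2.2, (x t).2 + S.yr (x t).1.1.2.1, (x t).1.1.1))
      (Ici t) t := fun t ht => (hx' t ht).prod_fst.prod_fst
  refine ⟨?_, ?_, mem_univ _⟩
  · have h1 := constant_of_has_deriv_right_zero (continuous_fst.comp_continuousOn hcz)
      (fun t ht => (hz t ht).prod_fst) s ⟨hs0, le_rfl⟩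
    simp only [Function.comp_apply] at h1
    rw [h1]
    exact hμ
  · obtain ⟨y, hy, hy0, hyW⟩ := hW _ hw
    have h1 := eqOn_of_locallyLipschitz hs (g := fun _ => 0)
      ((continuous_fst.comp continuous_snd).comp_continuousOn hcz)
      (hy.continuousOn.mono (Icc_subset_Ici_self : Icc 0 s ⊆ _))
      (fun t ht => by rw [add_zero]; exact (hz t ht).prod_snd.prod_fst)
      (fun t ht => by rw [add_zero]; exact hy.hasDerivWithinAt_Ici ht.1) hy0.symm ⟨hs0, le_rfl⟩
    simp only [Function.comp_apply] at h1
    rw [h1]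
    exact hyW s hs0

end Regularity

section Immersion

variable {S : Plant ν r n}

theorem hasDerivWithinAt_tauSeq {i : ℕ} (hi : ContDiff ℝ 1 (S.tauSeq i)) {x : ℝ → ZSpace ν r n}
    (hx : IsSolution (fun _ => S.f0) x) {t : ℝ} (ht : 0 ≤ t) :
    HasDerivWithinAt (fun t => S.tauSeq i (x t)) (S.tauSeq (i + 1) (x t)) (Ici 0) t :=
  ((hi.differentiable one_ne_zero).differentiableAt.hasFDerivAt).comp_hasDerivWithinAt t (hx t ht)

theorem iteratedDerivWithin_q0 (hτ : ∀ i < d, ContDiff ℝ 1 (S.tauSeq i)) {x : ℝ → ZSpace ν r n}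
    (hx : IsSolution (fun _ => S.f0) x) :
    ∀ i ≤ d, ∀ t, 0 ≤ t →
      iteratedDerivWithin i (fun t' => S.q0 (x t')) (Ici 0) t = S.tauSeq i (x t) := by
  intro i
  induction i with
  | zero => intro _ t _; rw [iteratedDerivWithin_zero]; rfl
  | succ i ih =>
    intro hi t ht
    rw [iteratedDerivWithin_succ, derivWithin_congr (s := Ici 0) (fun s hs => ih (by omega) s hs)
      (ih (by omega) t ht)]
    exact (hasDerivWithinAt_tauSeq (hτ i (by omega)) hx ht).derivWithin
      (uniqueDiffOn_Ici 0 t ht)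

/-- Along solutions in `A₀` the immersion makes `τ` a solution of `σ̇ = Φ_c(σ)`. -/
theorem isSolution_tau [NeZero d] {P : Set (Vec ν)} {W : Set (Vec r)} {Z : Set (Vec n)}
    (hτ : ∀ i < d, ContDiff ℝ 1 (S.tauSeq i)) {φ φc : Vec d → ℝ}
    (himm : S.SatisfiesImmersion P W Z φ) (hφc : EqOn φc φ (S.tau d '' S.A0 P W Z))
    {x : ℝ → ZSpace ν r n} (hx : IsSolution (fun _ => S.f0) x)
    (hxA : ∀ t, 0 ≤ t → x t ∈ S.A0 P W Z) :
    IsSolution (fun _ => PhiC φc) fun t => S.tau d (x t) := by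
  intro t ht
  have hd : S.tauSeq d (x t) = -φc (S.tau d (x t)) := by
    have h1 := himm x hx (hxA 0 le_rfl) t ht
    rw [iteratedDerivWithin_q0 hτ hx d le_rfl t ht] at h1
    have h2 : (WithLp.toLp 2 (fun i : Fin d =>
        iteratedDerivWithin i (fun t' => S.q0 (x t')) (Ici 0) t) : Vec d) = S.tau d (x t) := by
      unfold tau
      congr 1
      funext i
      exact iteratedDerivWithin_q0 hτ hx i i.2.le t ht
    rw [h2, ← hφc ⟨x t, hxA t ht, rfl⟩] at h1
    linarith
  have h1 : HasDerivWithinAt (fun t => fun i : Fin d => S.tauSeq i (x t))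
      (fun i : Fin d => S.tauSeq (i + 1) (x t)) (Ici 0) t :=
    hasDerivWithinAt_pi.2 fun i => hasDerivWithinAt_tauSeq (hτ i i.2) hx ht
  have h2 := (PiLp.continuousLinearEquiv 2 ℝ
    fun _ : Fin d => ℝ).symm.hasFDerivAt.comp_hasDerivWithinAt t h1
  have h3 : PhiC φc (S.tau d (x t)) =
      (WithLp.toLp 2 fun i : Fin d => S.tauSeq (i + 1) (x t) : Vec d) := by
    unfold PhiC
    congr 1
    funext i
    split_ifs with h
    · rfl
    · rw [show (i : ℕ) + 1 = d by have := i.2; omega, hd]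
  change HasDerivWithinAt _ (PhiC φc (S.tau d (x t))) _ _
  rw [h3]
  exact h2

end Immersion

section Attractor

variable {S : Plant ν r n} {P : Set (Vec ν)} {W : Set (Vec r)} {Z : Set (Vec n)}

/-- The attractor of the plant with the regulated error at zero drives the observer, in the sense of
`DrivingSystem`, and it attracts all of `P × W × Z`. -/
theorem exists_drivingSystem [NeZero d] (hs : LocallyLipschitz S.s) (hyr : ContDiff ℝ 1 S.yr)
    (hf : ContDiff ℝ 1 S.f) (hτ : ∀ i < d, ContDiff ℝ 1 (S.tauSeq i))
    (hne : (P ×ˢ W ×ˢ (univ : Set (Vec n))).Nonempty) (hattr : S.HasExpStableAttractor P W Z)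
    {φ φc : Vec d → ℝ} (himm : S.SatisfiesImmersion P W Z φ)
    (hφc : EqOn φc φ (S.tau d '' S.A0 P W Z)) :
    ∃ K, ∃ m ≥ 1, ∃ a > 0, ∃ ρ > 0,
      DrivingSystem S.f0 (S.tau d) φc (S.A0 P W Z) (P ×ˢ W ×ˢ (univ : Set (Vec n))) K m a ρ ∧
      (∀ z₀ ∈ P ×ˢ W ×ˢ (univ : Set (Vec n)), Metric.infDist z₀ (S.A0 P W Z) ≤ ρ →
        z₀ ∈ P ×ˢ W ×ˢ Z) ∧
      ∀ z₀ ∈ P ×ˢ W ×ˢ Z, ∃ z : ℝ → ZSpace ν r n, IsSolution (fun _ => S.f0) z ∧ z 0 = z₀ ∧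
        ∃ t, 0 ≤ t ∧ z t ∈ P ×ˢ W ×ˢ (univ : Set (Vec n)) ∧
          Metric.infDist (z t) (S.A0 P W Z) ≤ ρ := by
  obtain ⟨⟨K, hK, hKs, horb⟩, d₁, hd₁, hbasin, m, hm, a, ha, d₂, hd₂, hd₂₁, hexp⟩ := hattr
  have hlip := locallyLipschitz_f0 hs hyr hf
  have horb' : ∀ x : ℝ → ZSpace ν r n, IsSolution (fun _ => S.f0) x → x 0 ∈ P ×ˢ W ×ˢ Z →
      ∀ t, 0 ≤ t → x t ∈ K := by
    intro x hx hx0 t ht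
    obtain ⟨y, hy, hy0, hyK⟩ := horb _ hx0
    rw [hx.eqOn_autonomous hlip hy hy0.symm ht]
    exact hyK t ht
  have hA0K : S.A0 P W Z ⊆ K := omegaSet_subset hK.isClosed horb'
  have hclosed : IsClosed (S.A0 P W Z) := isClosed_omegaSet _ _
  have hcpt : IsCompact (S.A0 P W Z) := hK.of_isClosed_subset hclosed hA0K
  have hattract : ∀ x : ℝ → ZSpace ν r n, IsSolution (fun _ => S.f0) x → x 0 ∈ P ×ˢ W ×ˢ Z →
      ∃ y ∈ S.A0 P W Z, ∀ ε > 0, ∃ t, 0 ≤ t ∧ dist (x t) y < ε := fun x hx hx0 =>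
    exists_mem_omegaSet hK hx hx0 (horb' x hx hx0)
  -- the distance to the empty set is `0` by convention, so if `A₀` were empty, every point would
  -- lie in `P × W × Z` and its orbit would have a limit point
  have hA0ne : (S.A0 P W Z).Nonempty := by
    by_contra h
    rw [not_nonempty_iff_eq_empty] at h
    obtain ⟨z₀, hz₀⟩ := hne
    have h1 := hbasin z₀ hz₀ (by rw [h, Metric.infDist_empty]; exact hd₁.le)
    obtain ⟨x, hx, hx0, -⟩ := horb z₀ h1
    obtain ⟨y, hy, -⟩ := hattract x hx (by rw [hx0]; exact h1)
    rw [h] at hy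
    exact hy
  have hA0Z : S.A0 P W Z ⊆ P ×ˢ W ×ˢ Z := fun z hz =>
    hbasin z (hKs (hA0K hz)) (by rw [Metric.infDist_zero_of_mem hz]; exact hd₁.le)
  refine ⟨K, m, hm, a, ha, d₂, hd₂, ⟨hcpt, hA0ne, hA0K, ?_, ?_, ?_, ?_, ?_⟩,
    fun z hz hzd => hbasin z hz (hzd.trans hd₂₁), ?_⟩
  · exact hlip.locallyLipschitzOn.exists_lipschitzOnWith_of_compact hK
  · exact (locallyLipschitz_tau hτ).locallyLipschitzOn.exists_lipschitzOnWith_of_compact hK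
  · intro a₀ ha₀
    obtain ⟨α, hα, hα0, hαK⟩ := horb a₀ (hA0Z ha₀)
    have hαA : ∀ t, 0 ≤ t → α t ∈ S.A0 P W Z := by
      intro t ht
      have h0 : Metric.infDist a₀ (S.A0 P W Z) = 0 := Metric.infDist_zero_of_mem ha₀
      have h1 := hexp a₀ (hKs (hA0K ha₀)) (by rw [h0]; exact hd₂.le) α hα hα0 t ht
      rw [h0, mul_zero] at h1
      exact (hclosed.mem_iff_infDist_zero hA0ne).2 (le_antisymm h1 Metric.infDist_nonneg)
    exact ⟨α, hα, hα0, hαA, isSolution_tau hτ himm hφc hα hαA⟩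
  · intro z hz hzB hzd t ht
    have h1 := horb' z hz (hbasin _ hzB (hzd.trans hd₂₁)) t ht
    exact ⟨hKs h1, h1⟩
  · intro z hz hzB hzd t ht
    exact hexp (z 0) hzB hzd z hz rfl t ht
  · intro z₀ hz₀
    obtain ⟨z, hz, hz0, hzK⟩ := horb z₀ hz₀
    obtain ⟨y, hy, hlim⟩ := hattract z hz (by rw [hz0]; exact hz₀)
    obtain ⟨t, ht, hty⟩ := hlim d₂ hd₂
    exact ⟨z, hz, hz0, t, ht, hKs (hzK t ht),
      (Metric.infDist_le_dist_of_mem hy).trans hty.le⟩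

theorem isCompact_A (hτ : Continuous (S.tau d)) (hA0 : IsCompact (S.A0 P W Z)) :
    IsCompact (S.A d P W Z) := by
  have : S.A d P W Z = (fun z => (z, S.tau d z)) '' S.A0 P W Z := by
    ext ⟨z, ξ⟩
    constructor
    · rintro ⟨h1, h2⟩
      exact ⟨z, h1, Prod.ext rfl h2.symm⟩
    · rintro ⟨z', h1, h2⟩
      obtain ⟨rfl, rfl⟩ := Prod.mk.inj h2
      exact ⟨h1, rfl⟩
  rw [this]
  exact hA0.image (by fun_prop)

end Attractor

end Plant

end RemoteTracking

/-! ### The semiglobal regulator -/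

theorem lemma2 {ν r n d : ℕ} [NeZero d] (S : Plant ν r n)
    (P : Set (Vec ν)) (W : Set (Vec r)) (Z : Set (Vec n)) (Ξ : Set (Vec d))
    (hP : IsCompact P) (hW : IsCompact W) (hZ : IsCompact Z) (hΞ : IsCompact Ξ)
    -- regularity: `s` is locally Lipschitz, the other data are smooth enough for `τ` to be `C¹`
    (hs : LocallyLipschitz S.s) (hyr : ContDiff ℝ 1 S.yr)
    (hf : ContDiff ℝ 1 S.f) (hq : ContDiff ℝ 1 S.q)
    (hτ : ∀ i < d, ContDiff ℝ 1 (S.tauSeq i))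
    (hWinv : ForwardInvariant S.s W)
    (hattr : S.HasExpStableAttractor P W Z)
    (φ : Vec d → ℝ) (hφ : LocallyLipschitz φ) (himm : S.SatisfiesImmersion P W Z φ)
    -- the data of the regulator
    (φc : Vec d → ℝ) (hφc : LocallyLipschitz φc) (hφc_supp : HasCompactSupport φc)
    (hφc_eq : EqOn φc φ (S.tau d '' S.A0 P W Z))
    (c : Fin d → ℝ) (hc : IsHurwitz c)
    -- the size of the set `E` of initial errors
    (cE : ℝ) (hcE : 0 < cE) :
    ∃ κ' > 0, ∀ κ ≥ κ',
      (P ×ˢ W ×ˢ Z) ×ˢ Ξ ⊆ S.domainOfAttraction P W Z φc (gain c κ) ∧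
      ∀ K : Set (PSpace ν r n d), IsCompact K →
        K ⊆ S.domainOfAttraction P W Z φc (gain c κ) →
        ∃ k' : ℝ, ∀ k > k',
          S.BoundedAndConvergent P W Z φc (gain c κ) k cE K ∧
          S.LocallyTotallyStable P W Z φc (gain c κ) k := by
  obtain ⟨L, hL⟩ := exists_lipschitzWith_of_hasCompactSupport hφc hφc_supp
  obtain ⟨κ', hκ', hobs⟩ := exists_observerErrorBound hL hc
  refine ⟨κ', hκ', fun κ hκ => ?_⟩
  obtain ⟨C, hC, β, hβ, hobs⟩ := hobs κ hκ
  set G := gain c κ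
  set A := S.A d P W Z with hAdef
  set Ω : Set (PSpace ν r n d) := {p | p.1 ∈ P ×ˢ W ×ˢ (univ : Set (Vec n))} with hΩdef
  -- everything is vacuous when the state space is empty
  rcases (P ×ˢ W ×ˢ (univ : Set (Vec n))).eq_empty_or_nonempty with hemp | hne
  · have hΩ0 : ∀ p : PSpace ν r n d, p.1 ∉ P ×ˢ W ×ˢ (univ : Set (Vec n)) := fun p hp => by
      rw [hemp] at hp; exact hp
    refine ⟨fun p hp => (hΩ0 p ⟨hp.1.1, hp.1.2.1, mem_univ _⟩).elim, fun K _ hKD =>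
      ⟨0, fun k _ => ?_⟩⟩
    have hK0 : ∀ p, p ∉ K := fun p hp => hΩ0 p (hKD hp).1
    refine ⟨⟨fun p hp => (hK0 p hp).elim, ?_, fun x _ hx => (hK0 _ hx).elim⟩,
      fun ε hε => ⟨1, one_pos, 1, one_pos, fun p hp => (hΩ0 p hp).elim⟩⟩
    refine Bornology.isBounded_empty.subset ?_
    rintro y ⟨x, -, hx, -⟩
    exact (hK0 _ hx).elim
  obtain ⟨K₀, m, hm, a, ha, ρ, hρ, hdrive, hbasin, hreach⟩ :=
    Plant.exists_drivingSystem hs hyr hf hτ hne hattr himm hφc_eq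
  have hτc : Continuous (S.tau d) := (Plant.locallyLipschitz_tau hτ).continuous
  have hA : IsCompact A := Plant.isCompact_A hτc hdrive.isCompact
  have hAne : A.Nonempty := by
    obtain ⟨z, hz⟩ := hdrive.nonempty
    exact ⟨(z, S.tau d z), hz, rfl⟩
  obtain ⟨T, hT, M, hM, hgraph⟩ :=
    hdrive.exists_graph_contraction hm ha hC hβ hobs (A := A) rfl hA
  set g := S.openField φc G with hg
  have hg0 : (fun (_ : ℝ) (p : PSpace ν r n d) => (g (p, 0)).1) =
      fun _ => cascadeField S.f0 (S.tau d) φc G :=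
    funext fun _ => funext fun p => Plant.pField_zero φc G p
  have hF0 : S.F0 φc G = cascadeField S.f0 (S.tau d) φc G := rfl
  constructor
  · rintro ⟨z₀, ξ₀⟩ ⟨hz₀, -⟩
    refine ⟨⟨hz₀.1, hz₀.2.1, mem_univ _⟩, ?_⟩
    obtain ⟨z, hz, hz0, t₁, ht₁, hzB, hzd⟩ := hreach z₀ hz₀
    obtain ⟨ξ, hξ0, hp⟩ := exists_isSolution_cascadeField hτc hL G hz ξ₀
    refine ⟨fun t => (z t, ξ t), hp, by simp only [hz0, hξ0], ?_⟩
    obtain ⟨-, -, hlim⟩ := hgraph _ (hp.shift ht₁) (by simpa using hzB) (by simpa using hzd)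
    have h4 := hlim.comp (tendsto_atTop_add_const_right atTop (-t₁) tendsto_id)
    refine h4.congr fun t => ?_
    simp
    rfl
  intro K hK hKD
  have hglip : LocallyLipschitz g :=
    Plant.locallyLipschitz_openField hs hyr hf hq (hτ 0 (Nat.pos_of_neZero d)) hL G
  have hA0 : ∀ p ∈ A, (g (p, 0)).2 = 0 := by
    rintro ⟨z, ξ⟩ ⟨-, hξ⟩
    have h1 : ξ 0 = S.q0 z := by
      simp only at hξ
      rw [hξ]; rfl
    simp only [hg, Plant.openField, Plant.eField, zero_add, zero_smul, add_zero, h1, Plant.q0]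
    ring
  have hΩ : HighGainInvariant g Ω := Plant.highGainInvariant_openField hs hWinv φc G
  -- solutions from within `r₀` of `A` stay within distance `1`
  obtain ⟨r₀, hr₀, hr₀ρ, hMr⟩ : ∃ r₀ > 0, r₀ ≤ ρ ∧ M * r₀ ≤ 1 := by
    refine ⟨min ρ (1 / (M + 1)), by positivity, min_le_left _ _, ?_⟩
    have h1 : M * min ρ (1 / (M + 1)) ≤ M * (1 / (M + 1)) := by
      gcongr; exact min_le_right _ _
    refine h1.trans ?_
    rw [mul_one_div, div_le_one (by positivity)]
    linarith
  have hnom : NominalContraction g A Ω r₀ T M := by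
    intro p₀ hp₀ hpd
    have h1 : Metric.infDist p₀.1 (S.A0 P W Z) ≤ ρ := by
      obtain ⟨q, hq, hpq⟩ := hA.exists_infDist_eq_dist hAne p₀
      refine (Metric.infDist_le_dist_of_mem hq.1).trans ((le_max_left _ (dist p₀.2 q.2)).trans ?_)
      exact hpq.symm.le.trans (hpd.trans hr₀ρ)
    obtain ⟨z, hz, hz0, -⟩ := hreach _ (hbasin _ hp₀ h1)
    obtain ⟨ξ, hξ0, hp⟩ := exists_isSolution_cascadeField hτc hL G hz p₀.2
    have hp0 : (z 0, ξ 0) = p₀ := Prod.ext hz0 hξ0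
    obtain ⟨h2, h3, -⟩ :=
      hgraph _ hp (by simp only [hz0]; exact hp₀) (by simp only [hz0]; exact h1)
    simp only [hp0] at h2 h3
    exact ⟨fun t => (z t, ξ t), by rw [hg0]; exact hp, hp0, h2, h3⟩
  obtain ⟨k₁, hstab⟩ :=
    exists_gain_totally_stable hglip hA hAne hA0 hΩ hr₀ hT hM hMr hnom
  obtain ⟨k₂, R, hconv⟩ :=
    exists_gain_attracted_compact hglip hA hAne hA0 hΩ hr₀ hT hM hMr hnom hcE.le hK
      (fun p₀ hp₀ => by
      obtain ⟨h1, p, hp, hp0, hlim⟩ := hKD hp₀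
      exact ⟨h1, p, by rw [hg0, ← hF0]; exact hp, hp0, hlim⟩)
  refine ⟨max k₁ k₂, fun k hk => ⟨?_, ?_⟩⟩
  · have hconv := hconv k ((le_max_right _ _).trans_lt hk)
    have hall : ∀ y : ℝ → PSpace ν r n d × ℝ, IsSolution (S.closedLoop φc G k fun _ => 0) y →
        (y 0).1 ∈ K → |(y 0).2| ≤ cE → (∀ t, 0 ≤ t → ‖y t‖ ≤ R) ∧
        Tendsto (fun t => Metric.infDist (y t).1 A + |(y t).2|) atTop (𝓝 0) := by
      intro y hy hy1 hy2
      rw [Plant.closedLoop_eq_highGainField] at hy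
      obtain ⟨x, hx, hx0, hxR, hlim⟩ := hconv _ hy1 _ hy2
      have heq := isSolution_highGainField_eqOn hglip hy hx hx0.symm
      refine ⟨fun t ht => by rw [heq ht]; exact hxR t ht, hlim.congr' ?_⟩
      filter_upwards [eventually_ge_atTop 0] with t ht
      rw [heq ht]
    refine ⟨fun p₀ hp₀ e₀ he₀ => ?_, ?_, fun y hy hy1 hy2 => ?_⟩
    · obtain ⟨x, hx, hx0, -⟩ := hconv p₀ hp₀ e₀ he₀
      exact ⟨x, by rw [Plant.closedLoop_eq_highGainField]; exact hx, hx0⟩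
    · refine (Metric.isBounded_closedBall (x := 0) (r := R)).subset ?_
      rintro _ ⟨y, hy, hy1, hy2, t, ht, rfl⟩
      simpa using (hall y hy hy1 hy2).1 t ht
    · have hlim := (hall y hy hy1 hy2).2
      refine ⟨squeeze_zero (fun t => Metric.infDist_nonneg)
        (fun t => le_add_of_nonneg_right (abs_nonneg _)) hlim, ?_⟩
      refine (tendsto_zero_iff_abs_tendsto_zero _).2 (squeeze_zero (fun t => abs_nonneg _)
        (fun t => le_add_of_nonneg_left Metric.infDist_nonneg) hlim)
  · intro ε hε
    obtain ⟨δ₁, hδ₁, δ₂, hδ₂, h⟩ := hstab k ((le_max_left _ _).trans_lt hk) ε hε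
    refine ⟨δ₁, hδ₁, δ₂, hδ₂, fun p₀ hp₀ hpd e₀ he₀ u hu huδ => ?_⟩
    rw [Plant.closedLoop_eq_highGainField]
    exact h p₀ hp₀ hpd e₀ he₀ u hu huδ
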